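/- For a Dirichlet character $\chi$ modulo $q$ (with $q\geq 1$), let $L(s,\chi)=\sum_{n\geq 1}\chi(n)n^{-s}$, which converges absolutely for $\operatorname{Re}(s)>1$. Then for every integer $N\geq 2$, every integer $q\geq 1$ and every Dirichlet character $\chi$ modulo $q$ (primitive or not, principal or not), the function $$L(s,\chi)+L(2s,\chi)+\cdots+L(Ns,\chi)$$ has infinitely many zeros in the half-plane $\operatorname{Re}(s)>1$. -/

import Mathlib

/-! Replace every `n ^ (-s)` by `exp (i θ n) * n ^ (-s)`, with `θ` completely additive, so that the
`k`-th summand is rotated by `exp (i k θ n)`. The choice `θ n = -t log n` is the vertical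
translation by `t`. By Kronecker's theorem these translations, with `t` arbitrarily large,
approximate any `θ`, uniformly on compact discs in `Re s > 1`. By a Rouché-type argument a single
zero of a single twisted sum therefore produces zeros of the original sum at arbitrarily large
height (`infinite_zeros_of_twistedSum_eq_zero`).

It remains to find a twist with a zero at some real `σ > 1` (`exists_twistedSum_eq_zero`). The term
`k = 1` is an Euler product, whose phases at the primes are free. The terms `k ≥ 2` add up to `(N -
1) G` with `|G - 1| ≤ 13/20`, and `G` is Lipschitz in the phases uniformly in `σ`. Give the `n`-th
prime not dividing `q` the phase `i ^ n`, so that the logarithm of the Euler product stays bounded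
by cancellation as `σ → 1`. Then turn the classes `n ≡ 0` and `n ≡ 1` mod `4` by the angles `Re z`
and `Im z`: the logarithm moves by about `i R z`, where `R` is the sum of `p ^ (-σ)` over one class,
and `R → ∞` as `σ → 1`. For `σ` near `1` a small disc of `z` thus covers the value `log (N - 1) + π
i` of `eulerLog - log G`, which makes the two parts cancel. -/

/-! ### Completely additive phases -/

/-- The completely additive extension of a function on the primes. -/
noncomputable def addExt (θ : ℕ → ℝ) (n : ℕ) : ℝ :=
  n.factorization.sum fun p k => (k : ℝ) * θ p

theorem addExt_mul (θ : ℕ → ℝ) {m n : ℕ} (hm : m ≠ 0) (hn : n ≠ 0) :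
    addExt θ (m * n) = addExt θ m + addExt θ n := by
  unfold addExt
  rw [Nat.factorization_mul hm hn, Finsupp.sum_add_index']
  · intro p; simp
  · intro p a b; push_cast; ring

theorem addExt_prime (θ : ℕ → ℝ) {p : ℕ} (hp : p.Prime) : addExt θ p = θ p := by
  simp [addExt, hp.factorization]

/-- Compare with `log n = ∑ v_p(n) log p`: every `log p` is at least `1/2`, whence the factor `2`.
-/
theorem abs_addExt_sub_le {θ θ' : ℕ → ℝ} {δ : ℝ} (h : ∀ p : ℕ, p.Prime → |θ p - θ' p| ≤ δ)
    (n : ℕ) : |addExt θ n - addExt θ' n| ≤ 2 * δ * Real.log n := by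
  have hδ : 0 ≤ δ := (abs_nonneg _).trans (h 2 Nat.prime_two)
  unfold addExt
  rw [Real.log_nat_eq_sum_factorization, Finsupp.sum, Finsupp.sum, Finsupp.sum,
    ← Finset.sum_sub_distrib, Finset.mul_sum]
  refine (Finset.abs_sum_le_sum_abs _ _).trans (Finset.sum_le_sum fun p hp => ?_)
  have hp' : p.Prime := Nat.prime_of_mem_primeFactors (by simpa using hp)
  rw [← mul_sub, abs_mul, Nat.abs_cast]
  have h1 : (1 : ℝ) / 2 ≤ Real.log p := by
    have h2 : Real.log 2 ≤ Real.log p :=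
      Real.log_le_log (by norm_num) (by exact_mod_cast hp'.two_le)
    have := Real.log_two_gt_d9
    linarith
  have h3 : |θ p - θ' p| ≤ 2 * δ * Real.log p := by
    have := h p hp'
    nlinarith
  calc (n.factorization p : ℝ) * |θ p - θ' p|
      ≤ (n.factorization p : ℝ) * (2 * δ * Real.log p) := by gcongr
    _ = _ := by ring

/-! ### Kronecker's theorem for the logarithms of the integers -/

open Filter Topology MeasureTheory

theorem tendsto_mean_exp (T a c : ℝ) :
    Tendsto (fun X : ℝ => (X : ℂ)⁻¹ * ∫ t in T..(T + X), Complex.exp (((a * t + c : ℝ) : ℂ) * Complex.I))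
      atTop (𝓝 (if a = 0 then Complex.exp ((c : ℂ) * Complex.I) else 0)) := by
  split_ifs with ha
  · subst ha
    refine tendsto_const_nhds.congr' ?_
    filter_upwards [eventually_gt_atTop 0] with X hX
    have : (X : ℂ) ≠ 0 := by exact_mod_cast hX.ne'
    simp [this]
  · have hb : ∀ X : ℝ, 0 < X → ‖(X : ℂ)⁻¹ *
        ∫ t in T..(T + X), Complex.exp (((a * t + c : ℝ) : ℂ) * Complex.I)‖ ≤ X⁻¹ * (2 / |a|) := by
      intro X hX
      rw [norm_mul, norm_inv, Complex.norm_real, Real.norm_of_nonneg hX.le]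
      gcongr
      have haI : (a : ℂ) * Complex.I ≠ 0 := by simp [ha]
      have hint : ∫ t in T..(T + X), Complex.exp (((a * t + c : ℝ) : ℂ) * Complex.I)
          = Complex.exp ((c : ℂ) * Complex.I) * ∫ t in T..(T + X),
            Complex.exp ((a : ℂ) * Complex.I * t) := by
        rw [← intervalIntegral.integral_const_mul]
        refine intervalIntegral.integral_congr fun t _ => ?_
        rw [← Complex.exp_add]
        congr 1; push_cast; ring
      rw [hint, integral_exp_mul_complex haI, norm_mul, Complex.norm_exp_ofReal_mul_I, one_mul,
        norm_div, norm_mul, Complex.norm_I, mul_one, Complex.norm_real, Real.norm_eq_abs]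
      gcongr
      refine (norm_sub_le _ _).trans ?_
      have : ∀ x : ℝ, ‖Complex.exp ((a : ℂ) * Complex.I * x)‖ = 1 := by
        intro x
        rw [show (a : ℂ) * Complex.I * x = ((a * x : ℝ) : ℂ) * Complex.I by push_cast; ring,
          Complex.norm_exp_ofReal_mul_I]
      rw [this, this]; norm_num
    refine squeeze_zero_norm' ((eventually_gt_atTop 0).mono hb) ?_
    simpa using tendsto_inv_atTop_zero.mul_const (2 / |a|)

/-- The terms other than `u i` and `u i₀ = 1` contribute at most `card - 2`, so `‖u i + 1‖ > 2 - η`;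
the parallelogram law turns this into a bound for `‖u i - 1‖`. -/
theorem norm_one_sub_le_of_norm_sum {ι : Type*} [DecidableEq ι] (S : Finset ι) (u : ι → ℂ)
    (hu : ∀ i ∈ S, ‖u i‖ = 1) {i₀ : ι} (h₀ : i₀ ∈ S) (hu₀ : u i₀ = 1) {η : ℝ}
    (hS : (S.card : ℝ) - η < ‖∑ i ∈ S, u i‖) {i : ι} (hi : i ∈ S) : ‖u i - 1‖ ^ 2 ≤ 4 * η := by
  have hη : 0 < η := by
    have : ‖∑ i ∈ S, u i‖ ≤ S.card := by
      refine (norm_sum_le _ _).trans ?_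
      rw [Finset.sum_congr rfl hu]; simp
    linarith
  by_cases hii : i = i₀
  · subst hii; simp [hu₀]; exact hη.le
  have h1 : 2 - η < ‖u i + 1‖ := by
    have h2 : ∑ j ∈ S, u j = (u i + 1) + ∑ j ∈ (S.erase i).erase i₀, u j := by
      rw [← Finset.add_sum_erase S u hi,
        ← Finset.add_sum_erase (S.erase i) u (Finset.mem_erase.2 ⟨fun h => hii h.symm, h₀⟩), hu₀]
      ring
    have h3 : ‖∑ j ∈ (S.erase i).erase i₀, u j‖ ≤ S.card - 2 := by
      refine (norm_sum_le _ _).trans ?_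
      rw [Finset.sum_congr rfl fun j hj => hu j (Finset.mem_of_mem_erase (Finset.mem_of_mem_erase hj))]
      have hc1 := Finset.card_erase_add_one hi
      have hc2 := Finset.card_erase_add_one
        (Finset.mem_erase.2 ⟨fun h => hii h.symm, h₀⟩ : i₀ ∈ S.erase i)
      simp only [Finset.sum_const, nsmul_eq_mul, mul_one]
      have : (((S.erase i).erase i₀).card : ℝ) + 1 + 1 = S.card := by
        rw [← hc1, ← hc2]; push_cast; ring
      linarith
    have h4 := norm_add_le (u i + 1) (∑ j ∈ (S.erase i).erase i₀, u j)
    rw [← h2] at h4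
    linarith
  have h5 := parallelogram_law_with_norm ℝ (u i) 1
  rw [hu i hi] at h5
  simp only [norm_one] at h5
  by_cases hη2 : η ≤ 2
  · nlinarith
  · nlinarith [norm_nonneg (u i + 1)]

/-- A moment argument. If the sum had norm at most `M - η` for all `t ≥ T`, its `m`-th power would
be at most `(M - η) ^ m`. Yet a mean value against only polynomially many frequencies recovers all
of `M ^ m`. -/
theorem exists_norm_sum_exp_gt {θ : ℕ → ℝ}
    (hθ : ∀ m n : ℕ, m ≠ 0 → n ≠ 0 → θ (m * n) = θ m + θ n) (M : ℕ) (T η : ℝ) (hη : 0 < η) :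
    ∃ t, T ≤ t ∧ (M : ℝ) - η < ‖∑ n ∈ Finset.Icc 1 M,
      Complex.exp (((-(t * Real.log n) - θ n : ℝ) : ℂ) * Complex.I)‖ := by
  classical
  by_contra! H
  set g : ℝ → ℕ → ℂ := fun t n => Complex.exp (((-(t * Real.log n) - θ n : ℝ) : ℂ) * Complex.I)
    with hg
  have hg1 : ∀ t n, ‖g t n‖ = 1 := fun t n => Complex.norm_exp_ofReal_mul_I _
  have hgmul : ∀ t m n, m ≠ 0 → n ≠ 0 → g t (m * n) = g t m * g t n := by
    intro t m n hm hn
    simp only [hg]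
    rw [← Complex.exp_add, hθ m n hm hn, Nat.cast_mul,
      Real.log_mul (by exact_mod_cast hm) (by exact_mod_cast hn)]
    congr 1; push_cast; ring
  have hθ1 : θ 1 = 0 := by simpa using hθ 1 1 one_ne_zero one_ne_zero
  have hgone : ∀ t, g t 1 = 1 := by intro t; simp [hg, hθ1]
  have hgpow : ∀ t n k, n ≠ 0 → g t (n ^ k) = g t n ^ k := by
    intro t n k hn
    induction k with
    | zero => simp [hgone]
    | succ k ih => rw [pow_succ, hgmul t _ _ (pow_ne_zero _ hn) hn, ih, pow_succ]
  have hgprod : ∀ t (k : ℕ → ℕ) (S : Finset ℕ), (∀ n ∈ S, n ≠ 0) →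
      g t (∏ n ∈ S, n ^ k n) = ∏ n ∈ S, g t n ^ k n := by
    intro t k S
    induction S using Finset.induction_on with
    | empty => intro _; simp [hgone]
    | insert a S ha ih =>
      intro hS
      have hS' : ∀ n ∈ S, n ≠ 0 := fun n hn => hS n (Finset.mem_insert_of_mem hn)
      have ha0 : a ≠ 0 := hS a (Finset.mem_insert_self _ _)
      rw [Finset.prod_insert ha, Finset.prod_insert ha, hgmul t _ _ (pow_ne_zero _ ha0)
        (Finset.prod_ne_zero_iff.2 fun n hn => pow_ne_zero _ (hS' n hn)), ih hS', hgpow t _ _ ha0]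
  set S := Finset.Icc 1 M with hSdef
  have hS0 : ∀ n ∈ S, n ≠ 0 := by
    intro n hn; have := (Finset.mem_Icc.1 hn).1; omega
  -- the main inequality
  have key : ∀ m : ℕ, (M : ℝ) ^ m ≤ (M - η) ^ m * ((m : ℝ) + 1) ^ M := by
    intro m
    set K := Finset.piAntidiag S m with hK
    let P : (ℕ → ℕ) → ℕ := fun k => ∏ n ∈ S, n ^ k n
    have hP0 : ∀ k, P k ≠ 0 := fun k =>
      Finset.prod_ne_zero_iff.2 fun n hn => pow_ne_zero _ (hS0 n hn)
    set J := K.image P with hJ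
    have hJ0 : ∀ j ∈ J, j ≠ 0 := by
      intro j hj
      obtain ⟨k, -, rfl⟩ := Finset.mem_image.1 hj
      exact hP0 k
    have hcard : (J.card : ℝ) ≤ ((m : ℝ) + 1) ^ M := by
      -- Each of the `M` exponents lies between `0` and `m`.
      have h1 : J.card ≤ (m + 1) ^ M := by
        let Q : ((n : ℕ) → n ∈ S → ℕ) → ℕ := fun k => ∏ n ∈ S.attach, (n : ℕ) ^ k n n.2
        have h2 : J ⊆ (S.pi fun _ => Finset.range (m + 1)).image Q := by
          intro j hj
          obtain ⟨k, hk, rfl⟩ := Finset.mem_image.1 hj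
          rw [hK, Finset.mem_piAntidiag] at hk
          refine Finset.mem_image.2 ⟨fun n _ => k n, ?_, ?_⟩
          · rw [Finset.mem_pi]
            intro n hn
            have := Finset.single_le_sum (f := k) (fun i _ => Nat.zero_le _) hn
            have hsum : ∑ i ∈ S, k i = m := hk.1
            rw [Finset.mem_range]; omega
          · exact Finset.prod_attach S fun n => n ^ k n
        refine (Finset.card_le_card h2).trans (Finset.card_image_le.trans ?_)
        rw [Finset.card_pi]
        simp [hSdef]
      exact_mod_cast h1
    -- The second factor contains the conjugate of each frequency in the expansion of the power,
    -- exactly once.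
    let F : ℝ → ℂ := fun t => (∑ n ∈ S, g t n) ^ m * ∑ j ∈ J, (starRingEnd ℂ) (g t j)
    have hFb : ∀ t, T ≤ t → ‖F t‖ ≤ (M - η) ^ m * ((m : ℝ) + 1) ^ M := by
      intro t ht
      simp only [F]
      rw [norm_mul, norm_pow]
      have h1 := H t ht
      have h2 : ‖∑ j ∈ J, (starRingEnd ℂ) (g t j)‖ ≤ ((m : ℝ) + 1) ^ M := by
        refine (norm_sum_le _ _).trans (le_trans ?_ hcard)
        simp [hg1]
      have h0 : (0 : ℝ) ≤ M - η := (norm_nonneg _).trans h1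
      exact mul_le_mul (pow_le_pow_left₀ (norm_nonneg _) h1 m) h2 (norm_nonneg _) (by positivity)
    have hFexp : ∀ t, F t = ∑ k ∈ K, ∑ j ∈ J, (Nat.multinomial S k : ℂ) *
        Complex.exp (((-(Real.log (P k) - Real.log j) * t + -(θ (P k) - θ j) : ℝ) : ℂ) *
          Complex.I) := by
      intro t
      simp only [F]
      rw [Finset.sum_pow_eq_sum_piAntidiag, Finset.sum_mul_sum]
      refine Finset.sum_congr rfl fun k _ => Finset.sum_congr rfl fun j _ => ?_
      rw [← hgprod t k S hS0, mul_assoc]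
      congr 1
      simp only [hg]
      rw [← Complex.exp_conj, ← Complex.exp_add]
      congr 1
      simp only [map_mul, Complex.conj_I, Complex.conj_ofReal, P]
      push_cast; ring
    have hlim : Tendsto (fun X : ℝ => (X : ℂ)⁻¹ * ∫ t in T..(T + X), F t) atTop
        (𝓝 (((M : ℂ)) ^ m)) := by
      have hsum : ((M : ℂ)) ^ m = ∑ k ∈ K, ∑ j ∈ J, (Nat.multinomial S k : ℂ) *
          (if -(Real.log (P k) - Real.log j) = 0 then
            Complex.exp (((-(θ (P k) - θ j) : ℝ) : ℂ) * Complex.I) else 0) := by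
        have h1 : ((M : ℂ)) ^ m = ∑ k ∈ K, (Nat.multinomial S k : ℂ) := by
          have := Finset.sum_pow_eq_sum_piAntidiag S (fun _ => (1 : ℂ)) m
          simpa [hSdef] using this
        rw [h1]
        refine Finset.sum_congr rfl fun k hk => ?_
        -- Only `j = P k` has zero frequency, and there the phases cancel because `θ` depends on the
        -- product alone.
        rw [Finset.sum_eq_single (P k)]
        · simp
        · intro j hj hne
          rw [if_neg, mul_zero]
          intro h
          apply hne
          have h2 : Real.log (P k) = Real.log j := by linarith
          have h3 := Real.log_injOn_pos (Set.mem_Ioi.2 (by exact_mod_cast Nat.pos_of_ne_zero (hP0 k)))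
            (Set.mem_Ioi.2 (by exact_mod_cast Nat.pos_of_ne_zero (hJ0 j hj))) h2
          exact_mod_cast h3.symm
        · intro h
          exact absurd (Finset.mem_image_of_mem P hk) h
      rw [hsum]
      have hint : ∀ X : ℝ, (X : ℂ)⁻¹ * ∫ t in T..(T + X), F t = ∑ k ∈ K, ∑ j ∈ J,
          (Nat.multinomial S k : ℂ) * ((X : ℂ)⁻¹ * ∫ t in T..(T + X),
            Complex.exp (((-(Real.log (P k) - Real.log j) * t + -(θ (P k) - θ j) : ℝ) : ℂ) *
              Complex.I)) := by
        intro X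
        simp only [hFexp]
        rw [intervalIntegral.integral_finsetSum, Finset.mul_sum]
        · refine Finset.sum_congr rfl fun k _ => ?_
          rw [intervalIntegral.integral_finsetSum, Finset.mul_sum]
          · refine Finset.sum_congr rfl fun j _ => ?_
            rw [intervalIntegral.integral_const_mul]; ring
          · intro j _
            exact Continuous.intervalIntegrable (by fun_prop) _ _
        · intro k _
          exact Continuous.intervalIntegrable (by fun_prop) _ _
      simp only [hint]
      exact tendsto_finsetSum _ fun k _ => tendsto_finsetSum _ fun j _ =>
        (tendsto_mean_exp T _ _).const_mul _
    have hbd : ∀ᶠ X : ℝ in atTop, ‖(X : ℂ)⁻¹ * ∫ t in T..(T + X), F t‖ ≤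
        (M - η) ^ m * ((m : ℝ) + 1) ^ M := by
      filter_upwards [eventually_gt_atTop 0] with X hX
      rw [norm_mul, norm_inv, Complex.norm_real, Real.norm_of_nonneg hX.le]
      have := intervalIntegral.norm_integral_le_of_norm_le_const (a := T) (b := T + X) (f := F)
        (C := (M - η) ^ m * ((m : ℝ) + 1) ^ M) (fun t ht => hFb t (by
          rw [Set.uIoc_of_le (by linarith)] at ht; exact ht.1.le))
      rw [add_sub_cancel_left, abs_of_pos hX] at this
      rw [inv_mul_le_iff₀ hX, mul_comm X]
      exact this
    have := le_of_tendsto hlim.norm hbd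
    simpa using this
  have hMη : (0 : ℝ) ≤ M - η := (norm_nonneg _).trans (H T le_rfl)
  have hM : (0 : ℝ) < M := by linarith
  set r : ℝ := (M - η) / M with hr
  have hr0 : 0 ≤ r := by positivity
  have hr1 : r < 1 := by rw [hr, div_lt_one hM]; linarith
  have key2 : ∀ m : ℕ, 1 ≤ ((m + 1 : ℕ) : ℝ) ^ M * r ^ m := by
    intro m
    have := key m
    rw [hr, div_pow, mul_div_assoc', le_div_iff₀ (by positivity), one_mul]
    push_cast
    linarith
  have hlim := (tendsto_pow_const_mul_const_pow_of_abs_lt_one M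
    (by rwa [abs_of_nonneg hr0] : |r| < 1)).comp (tendsto_add_atTop_nat 1)
  -- `(m + 1) ^ M * r ^ (m + 1)` tends to `0` but is at least `r` by `key2`.
  have hle : r ≤ 0 := by
    refine ge_of_tendsto' hlim fun m => ?_
    have := key2 m
    simp only [Function.comp]
    rw [pow_succ, ← mul_assoc]
    nlinarith
  have hr00 : r = 0 := le_antisymm hle hr0
  have := key2 1
  rw [hr00] at this
  norm_num at this

/-- An inhomogeneous Kronecker theorem for the logarithms of the integers: a completely additive
phase is approximated by `n ^ (-it)` for arbitrarily large `t`. -/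
theorem exists_norm_exp_log_sub_lt {θ : ℕ → ℝ}
    (hθ : ∀ m n : ℕ, m ≠ 0 → n ≠ 0 → θ (m * n) = θ m + θ n) (M : ℕ) (T ε : ℝ) (hε : 0 < ε) :
    ∃ t, T ≤ t ∧ ∀ n : ℕ, 1 ≤ n → n ≤ M →
      ‖Complex.exp (((-(t * Real.log n) : ℝ) : ℂ) * Complex.I) -
        Complex.exp ((θ n : ℂ) * Complex.I)‖ < ε := by
  -- With `η = ε ^ 2 / 8` the squared distance is at most `4 η = ε ^ 2 / 2 < ε ^ 2`.
  obtain ⟨t, ht, h⟩ := exists_norm_sum_exp_gt hθ M T (ε ^ 2 / 8) (by positivity)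
  refine ⟨t, ht, fun n hn hnM => ?_⟩
  have hθ1 : θ 1 = 0 := by simpa using hθ 1 1 one_ne_zero one_ne_zero
  have h1 := norm_one_sub_le_of_norm_sum (Finset.Icc 1 M)
    (fun n : ℕ => Complex.exp (((-(t * Real.log n) - θ n : ℝ) : ℂ) * Complex.I))
    (fun i _ => Complex.norm_exp_ofReal_mul_I _) (i₀ := 1)
    (Finset.mem_Icc.2 ⟨le_rfl, hn.trans hnM⟩) (by simp [hθ1]) (by simpa using h)
    (Finset.mem_Icc.2 ⟨hn, hnM⟩)
  have h2 : Complex.exp (((-(t * Real.log n) : ℝ) : ℂ) * Complex.I) -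
      Complex.exp ((θ n : ℂ) * Complex.I) = Complex.exp ((θ n : ℂ) * Complex.I) *
        (Complex.exp (((-(t * Real.log n) - θ n : ℝ) : ℂ) * Complex.I) - 1) := by
    rw [mul_sub, ← Complex.exp_add, mul_one]
    congr 2; push_cast; ring
  rw [h2, norm_mul, Complex.norm_exp_ofReal_mul_I, one_mul]
  refine lt_of_pow_lt_pow_left₀ 2 hε.le ?_
  nlinarith [pow_pos hε 2]

/-! ### Twisted sums and their dependence on the phases -/

/-- The sum of the `L (k s, χ)`, `1 ≤ k ≤ N`, with every `n ^ (-s)` rotated by `exp (i θ n)`. -/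
noncomputable def twistedSum {q : ℕ} (χ : DirichletCharacter ℂ q) (N : ℕ) (θ : ℕ → ℝ) (s : ℂ) : ℂ :=
  ∑ k ∈ Finset.Icc 1 N, LSeries (fun n : ℕ => χ (n : ZMod q) *
    Complex.exp (((k * θ n : ℝ) : ℂ) * Complex.I)) ((k : ℂ) * s)

theorem norm_twist_le {q : ℕ} (χ : DirichletCharacter ℂ q) (k : ℕ) (θ : ℕ → ℝ) (n : ℕ) :
    ‖χ (n : ZMod q) * Complex.exp (((k * θ n : ℝ) : ℂ) * Complex.I)‖ ≤ 1 := by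
  rw [norm_mul, Complex.norm_exp_ofReal_mul_I, mul_one]
  exact χ.norm_le_one _

theorem norm_term_le_rpow {f : ℕ → ℂ} {C : ℝ} {n : ℕ} (hf : ‖f n‖ ≤ C) {w : ℂ} {σ : ℝ}
    (hσ : 1 < σ) (hw : σ ≤ w.re) : ‖LSeries.term f w n‖ ≤ C * (n : ℝ) ^ (-σ) := by
  rcases eq_or_ne n 0 with rfl | hn
  · simp [Real.zero_rpow (by linarith : -σ ≠ 0)]
  · have hn1 : (1 : ℝ) ≤ n := by exact_mod_cast Nat.one_le_iff_ne_zero.2 hn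
    rw [LSeries.norm_term_eq, if_neg hn, Real.rpow_neg (by positivity), div_eq_mul_inv]
    have hC := (norm_nonneg _).trans hf
    gcongr

theorem summable_rpow_neg {σ : ℝ} (hσ : 1 < σ) : Summable fun n : ℕ => (n : ℝ) ^ (-σ) :=
  Real.summable_nat_rpow.2 (by linarith)

theorem norm_LSeries_sub_le {f g : ℕ → ℂ} {w : ℂ} {σ : ℝ} (hσ : 1 < σ) (hw : σ ≤ w.re)
    (hf : ∀ n, ‖f n‖ ≤ 1) (hg : ∀ n, ‖g n‖ ≤ 1) {b : ℕ → ℝ} (hb : ∀ n, n ≠ 0 → ‖f n - g n‖ ≤ b n)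
    (hsum : Summable fun n : ℕ => b n * (n : ℝ) ^ (-σ)) :
    ‖LSeries f w - LSeries g w‖ ≤ ∑' n : ℕ, b n * (n : ℝ) ^ (-σ) := by
  have hfs : Summable (LSeries.term f w) :=
    LSeriesSummable_of_bounded_of_one_lt_re (m := 1) (fun n _ => hf n) (by linarith)
  have hgs : Summable (LSeries.term g w) :=
    LSeriesSummable_of_bounded_of_one_lt_re (m := 1) (fun n _ => hg n) (by linarith)
  unfold LSeries
  rw [← hfs.tsum_sub hgs]
  refine tsum_of_norm_bounded hsum.hasSum fun n => ?_
  rcases eq_or_ne n 0 with rfl | hn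
  · simp [Real.zero_rpow (by linarith : -σ ≠ 0)]
  have : LSeries.term f w n - LSeries.term g w n = LSeries.term (fun n => f n - g n) w n := by
    simp only [LSeries.term_of_ne_zero hn]; ring
  rw [this]
  exact norm_term_le_rpow (f := fun n => f n - g n) (hb n hn) hσ hw

/-- The constant comes from `ζ(2) - 1 = π² / 6 - 1 < 13/20`; that it is less than `1` keeps such
series away from `0`. -/
theorem norm_LSeries_sub_one_le {f : ℕ → ℂ} {w : ℂ} (hw : 2 ≤ w.re) (hf : ∀ n, ‖f n‖ ≤ 1)
    (hf1 : f 1 = 1) : ‖LSeries f w - 1‖ ≤ 13 / 20 := by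
  have h0 : Summable (LSeries.term f w) :=
    LSeriesSummable_of_bounded_of_one_lt_re (m := 1) (fun n _ => hf n) (by linarith)
  have h1 : HasSum (fun n : ℕ => LSeries.term f w n - if n = 1 then 1 else 0) (LSeries f w - 1) :=
    HasSum.sub h0.hasSum (hasSum_ite_eq 1 1)
  have h2 : HasSum (fun n : ℕ => 1 / (n : ℝ) ^ 2 - if n = 1 then 1 else 0) (Real.pi ^ 2 / 6 - 1) :=
    hasSum_zeta_two.sub (hasSum_ite_eq 1 1)
  have h3 : ‖LSeries f w - 1‖ ≤ Real.pi ^ 2 / 6 - 1 := by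
    rw [← h1.tsum_eq]
    refine tsum_of_norm_bounded h2 fun n => ?_
    by_cases hn : n = 1
    · subst hn
      simp [LSeries.term_of_ne_zero, hf1]
    · simp only [hn, if_false, sub_zero]
      refine (norm_term_le_rpow (hf n) (by norm_num : (1 : ℝ) < 2) hw).trans ?_
      rw [Real.rpow_neg (by positivity)]
      norm_num
  have := Real.pi_lt_d4
  have := Real.pi_pos
  nlinarith

theorem norm_exp_mul_sub_le (k : ℕ) (x y : ℝ) :
    ‖Complex.exp (((k * x : ℝ) : ℂ) * Complex.I) - Complex.exp (((k * y : ℝ) : ℂ) * Complex.I)‖ ≤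
      k * ‖Complex.exp ((x : ℂ) * Complex.I) - Complex.exp ((y : ℂ) * Complex.I)‖ := by
  have h : ∀ x : ℝ, Complex.exp (((k * x : ℝ) : ℂ) * Complex.I) =
      Complex.exp ((x : ℂ) * Complex.I) ^ k := by
    intro x
    rw [← Complex.exp_nat_mul]
    congr 1; push_cast; ring
  rw [h, h]
  set a := Complex.exp ((x : ℂ) * Complex.I) with ha
  set b := Complex.exp ((y : ℂ) * Complex.I) with hb
  have ha1 : ‖a‖ = 1 := Complex.norm_exp_ofReal_mul_I _
  have hb1 : ‖b‖ = 1 := Complex.norm_exp_ofReal_mul_I _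
  clear_value a b
  induction k with
  | zero => simp
  | succ k ih =>
    have h2 : a ^ (k + 1) - b ^ (k + 1) = a * (a ^ k - b ^ k) + (a - b) * b ^ k := by ring
    rw [h2]
    refine (norm_add_le _ _).trans ?_
    rw [norm_mul, norm_mul, norm_pow, ha1, hb1]
    have ih' := ih (fun x => by rw [← Complex.exp_nat_mul]; congr 1; push_cast; ring)
    push_cast
    simp only [one_pow, one_mul, mul_one]
    linarith

theorem norm_twist_sub_le {q : ℕ} (χ : DirichletCharacter ℂ q) (k : ℕ) (x y : ℝ) (n : ℕ) :
    ‖χ (n : ZMod q) * Complex.exp (((k * x : ℝ) : ℂ) * Complex.I) -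
      χ (n : ZMod q) * Complex.exp (((k * y : ℝ) : ℂ) * Complex.I)‖ ≤
      k * ‖Complex.exp ((x : ℂ) * Complex.I) - Complex.exp ((y : ℂ) * Complex.I)‖ := by
  rw [← mul_sub, norm_mul]
  refine le_trans ?_ (norm_exp_mul_sub_le k x y)
  exact mul_le_of_le_one_left (norm_nonneg _) (χ.norm_le_one _)

/-- The bound does not depend on `s` in `Re s ≥ σ`, so smallness of one series gives uniform
closeness on a disc. One factor `N` counts the summands, the other bounds the `k` in `k θ n`. -/
theorem norm_twistedSum_sub_le {q : ℕ} (χ : DirichletCharacter ℂ q) (N : ℕ) {θ θ' : ℕ → ℝ} {s : ℂ}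
    {σ : ℝ} (hσ : 1 < σ) (hs : σ ≤ s.re) :
    ‖twistedSum χ N θ s - twistedSum χ N θ' s‖ ≤
      N * (N * ∑' n : ℕ, ‖Complex.exp ((θ n : ℂ) * Complex.I) -
        Complex.exp ((θ' n : ℂ) * Complex.I)‖ * (n : ℝ) ^ (-σ)) := by
  unfold twistedSum
  set b : ℕ → ℝ := fun n => ‖Complex.exp ((θ n : ℂ) * Complex.I) -
        Complex.exp ((θ' n : ℂ) * Complex.I)‖ with hb
  have hb2 : ∀ n, b n ≤ 2 := fun n => by
    refine (norm_sub_le _ _).trans ?_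
    rw [Complex.norm_exp_ofReal_mul_I, Complex.norm_exp_ofReal_mul_I]; norm_num
  have hsum : Summable fun n : ℕ => b n * (n : ℝ) ^ (-σ) :=
    Summable.of_nonneg_of_le (fun n => by positivity)
      (fun n => mul_le_mul_of_nonneg_right (hb2 n) (by positivity))
      ((summable_rpow_neg hσ).mul_left 2)
  have h0 : 0 ≤ ∑' n : ℕ, b n * (n : ℝ) ^ (-σ) := tsum_nonneg fun n => by positivity
  rw [← Finset.sum_sub_distrib]
  refine (norm_sum_le_of_le _ (n := fun _ => (N : ℝ) * ∑' n : ℕ, b n * (n : ℝ) ^ (-σ)) fun k hk => ?_).trans ?_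
  · obtain ⟨hk1, hkN⟩ := Finset.mem_Icc.1 hk
    have hk1' : (1 : ℝ) ≤ k := by exact_mod_cast hk1
    have hkN' : (k : ℝ) ≤ N := by exact_mod_cast hkN
    have hre : σ ≤ ((k : ℂ) * s).re := by
      simp only [Complex.mul_re, Complex.natCast_re, Complex.natCast_im, zero_mul, sub_zero]
      nlinarith
    have h1 := norm_LSeries_sub_le hσ hre (norm_twist_le χ k θ) (norm_twist_le χ k θ')
      (b := fun n => k * b n) (fun n _ => norm_twist_sub_le χ k (θ n) (θ' n) n)
      (by simpa only [mul_assoc] using hsum.mul_left (k : ℝ))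
    refine h1.trans ?_
    simp only [mul_assoc]
    rw [tsum_mul_left]
    gcongr
  · simp [hb]

theorem differentiableOn_twistedSum {q : ℕ} (χ : DirichletCharacter ℂ q) (N : ℕ) (θ : ℕ → ℝ) :
    DifferentiableOn ℂ (twistedSum χ N θ) {s | 1 < s.re} := by
  unfold twistedSum
  refine DifferentiableOn.fun_sum fun k hk => ?_
  have hk1 : (1 : ℝ) ≤ k := by exact_mod_cast (Finset.mem_Icc.1 hk).1
  refine (LSeries_differentiableOn _).comp (by fun_prop) fun s hs => ?_
  have hs' : 1 < s.re := hs
  refine lt_of_le_of_lt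
    (LSeries.abscissaOfAbsConv_le_of_le_const ⟨1, fun n _ => norm_twist_le χ k θ n⟩) ?_
  have : 1 < ((k : ℂ) * s).re := by
    simp only [Complex.mul_re, Complex.natCast_re, Complex.natCast_im, zero_mul, sub_zero]
    nlinarith
  exact_mod_cast this

/-- This shows that a twisted sum does not vanish identically, hence that its zeros are isolated. -/
theorem twistedSum_ne_zero_of_two_le_re {q : ℕ} (χ : DirichletCharacter ℂ q) {N : ℕ} (hN : 1 ≤ N)
    {θ : ℕ → ℝ} (hθ : θ 1 = 0) {s : ℂ} (hs : 2 ≤ s.re) : twistedSum χ N θ s ≠ 0 := by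
  intro h0
  have h1 : ‖twistedSum χ N θ s - N‖ ≤ N * (13 / 20) := by
    have : twistedSum χ N θ s - N = ∑ k ∈ Finset.Icc 1 N,
        (LSeries (fun n : ℕ => χ (n : ZMod q) *
          Complex.exp (((k * θ n : ℝ) : ℂ) * Complex.I)) ((k : ℂ) * s) - 1) := by
      rw [Finset.sum_sub_distrib]; simp [twistedSum]
    rw [this]
    refine (norm_sum_le_of_le _ (n := fun _ => (13 / 20 : ℝ)) fun k hk => ?_).trans (by simp)
    have hk1 : (1 : ℝ) ≤ k := by exact_mod_cast (Finset.mem_Icc.1 hk).1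
    refine norm_LSeries_sub_one_le ?_ (norm_twist_le χ k θ) (by simp [hθ])
    simp only [Complex.mul_re, Complex.natCast_re, Complex.natCast_im, zero_mul, sub_zero]
    nlinarith
  rw [h0, zero_sub, norm_neg, Complex.norm_natCast] at h1
  have : (1 : ℝ) ≤ N := by exact_mod_cast hN
  linarith

theorem twistedSum_neg_mul_log {q : ℕ} (χ : DirichletCharacter ℂ q) (N : ℕ) (t : ℝ) (s : ℂ) :
    twistedSum χ N (fun n => -(t * Real.log n)) s =
      ∑ k ∈ Finset.Icc 1 N, LSeries (fun n : ℕ => χ (n : ZMod q))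
        ((k : ℂ) * (s + t * Complex.I)) := by
  refine Finset.sum_congr rfl fun k _ => tsum_congr fun n => ?_
  rcases eq_or_ne n 0 with rfl | hn
  · simp
  have hn' : (n : ℂ) ≠ 0 := by exact_mod_cast hn
  rw [LSeries.term_of_ne_zero hn, LSeries.term_of_ne_zero hn, mul_add, Complex.cpow_add _ _ hn',
    div_mul_eq_div_div_swap]
  congr 1
  rw [div_eq_mul_inv, ← Complex.cpow_neg, Complex.cpow_def_of_ne_zero hn', ← Complex.natCast_log]
  congr 2
  push_cast; ring

/-! ### From a zero of a twisted sum to infinitely many zeros -/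

/-- The maximum principle for `1 / h`, in the role of Rouché's theorem. -/
theorem exists_eq_zero_of_norm_lt {h : ℂ → ℂ} {c : ℂ} {r m : ℝ} (hr : 0 < r)
    (hd : DifferentiableOn ℂ h (Metric.closedBall c r)) (hc : ‖h c‖ < m)
    (hm : ∀ z ∈ Metric.sphere c r, m ≤ ‖h z‖) : ∃ z ∈ Metric.closedBall c r, h z = 0 := by
  by_contra! H
  have hm0 : 0 < m := (norm_nonneg _).trans_lt hc
  have hdi : DiffContOnCl ℂ (fun z => (h z)⁻¹) (Metric.ball c r) := by
    refine DifferentiableOn.diffContOnCl ?_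
    rw [closure_ball c hr.ne']
    exact hd.inv H
  have h1 := Complex.norm_le_of_forall_mem_frontier_norm_le Metric.isBounded_ball hdi (C := m⁻¹)
    (fun z hz => by
      rw [frontier_ball c hr.ne'] at hz
      rw [norm_inv]
      exact inv_anti₀ hm0 (hm z hz)) (subset_closure (Metric.mem_ball_self hr))
  rw [norm_inv] at h1
  have hc0 : 0 < ‖h c‖ := norm_pos_iff.2 (H c (Metric.mem_closedBall_self hr.le))
  exact absurd ((inv_le_inv₀ hc0 hm0).1 h1) (not_le.2 hc)

/-- Apply Kronecker to `n ≤ M` with error `1 / (M + 1)` and let `M → ∞`; the terms are dominated by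
`2 n ^ (-σ)`. -/
theorem exists_tsum_norm_exp_sub_lt {θ : ℕ → ℝ}
    (hθ : ∀ m n : ℕ, m ≠ 0 → n ≠ 0 → θ (m * n) = θ m + θ n) {σ : ℝ} (hσ : 1 < σ) (T ε : ℝ)
    (hε : 0 < ε) : ∃ t, T ≤ t ∧ ∑' n : ℕ, ‖Complex.exp (((-(t * Real.log n) : ℝ) : ℂ) * Complex.I) -
        Complex.exp ((θ n : ℂ) * Complex.I)‖ * (n : ℝ) ^ (-σ) < ε := by
  choose t htT ht using fun M : ℕ =>
    exists_norm_exp_log_sub_lt hθ M T (1 / ((M : ℝ) + 1)) (by positivity)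
  have hlim : Tendsto (fun M : ℕ => ∑' n : ℕ,
      ‖Complex.exp (((-(t M * Real.log n) : ℝ) : ℂ) * Complex.I) -
        Complex.exp ((θ n : ℂ) * Complex.I)‖ * (n : ℝ) ^ (-σ)) atTop (𝓝 (∑' _ : ℕ, (0 : ℝ))) := by
    refine tendsto_tsum_of_dominated_convergence ((summable_rpow_neg hσ).mul_left 2) ?_ ?_
    · intro n
      rcases eq_or_ne n 0 with rfl | hn
      · simp [Real.zero_rpow (by linarith : -σ ≠ 0)]
      · have h1 : Tendsto (fun M : ℕ => ‖Complex.exp (((-(t M * Real.log n) : ℝ) : ℂ) * Complex.I) -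
            Complex.exp ((θ n : ℂ) * Complex.I)‖) atTop (𝓝 0) := by
          refine squeeze_zero' (Eventually.of_forall fun _ => norm_nonneg _) ?_
            (tendsto_one_div_add_atTop_nhds_zero_nat (𝕜 := ℝ))
          filter_upwards [eventually_ge_atTop n] with M hM
          exact (ht M n (Nat.one_le_iff_ne_zero.2 hn) hM).le
        simpa using h1.mul_const ((n : ℝ) ^ (-σ))
    · refine Eventually.of_forall fun M n => ?_
      rw [norm_mul, norm_norm, Real.norm_of_nonneg (by positivity : 0 ≤ (n : ℝ) ^ (-σ))]
      gcongr
      refine (norm_sub_le _ _).trans ?_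
      rw [Complex.norm_exp_ofReal_mul_I, Complex.norm_exp_ofReal_mul_I]; norm_num
  rw [tsum_zero] at hlim
  obtain ⟨M, hM⟩ := (hlim.eventually (gt_mem_nhds hε)).exists
  exact ⟨t M, htT M, hM⟩

theorem infinite_zeros_of_twistedSum_eq_zero {q : ℕ} (χ : DirichletCharacter ℂ q) {N : ℕ}
    (hN : 1 ≤ N) {θ : ℕ → ℝ} (hθ : ∀ m n : ℕ, m ≠ 0 → n ≠ 0 → θ (m * n) = θ m + θ n) {s₀ : ℂ}
    (hs₀ : 1 < s₀.re) (hzero : twistedSum χ N θ s₀ = 0) :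
    {s : ℂ | 1 < s.re ∧
      ∑ k ∈ Finset.Icc 1 N, LSeries (fun n : ℕ => χ (n : ZMod q)) ((k : ℂ) * s) = 0}.Infinite := by
  have hθ1 : θ 1 = 0 := by simpa using hθ 1 1 one_ne_zero one_ne_zero
  have hopen : IsOpen {s : ℂ | 1 < s.re} := isOpen_lt continuous_const Complex.continuous_re
  have han : AnalyticOnNhd ℂ (twistedSum χ N θ) {s | 1 < s.re} :=
    (differentiableOn_twistedSum χ N θ).analyticOnNhd hopen
  have hne : ∀ᶠ s in 𝓝[≠] s₀, twistedSum χ N θ s ≠ 0 := by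
    by_contra hcon
    have hfreq : ∃ᶠ s in 𝓝[≠] s₀, twistedSum χ N θ s = 0 := hcon
    have := han.eqOn_zero_of_preconnected_of_frequently_eq_zero
      (convex_halfSpace_re_gt 1).isPreconnected hs₀ hfreq
    exact twistedSum_ne_zero_of_two_le_re χ hN hθ1 (s := 2) (by simp) (this (by simp))
  obtain ⟨r₀, hr₀, hball⟩ := Metric.eventually_nhds_iff_ball.1 (eventually_nhdsWithin_iff.1 hne)
  set σ : ℝ := (1 + s₀.re) / 2 with hσ
  have hσ1 : 1 < σ := by linarith
  -- The first bound excludes other zeros from the disc, the second keeps the disc in `Re z ≥ σ`.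
  set r : ℝ := min (r₀ / 2) ((s₀.re - 1) / 2) with hr
  have hrpos : 0 < r := lt_min (by linarith) (by linarith)
  have hre : ∀ z ∈ Metric.closedBall s₀ r, σ ≤ z.re := by
    intro z hz
    have h1 : |(z - s₀).re| ≤ r := (Complex.abs_re_le_norm _).trans (by simpa [dist_eq_norm] using hz)
    have h2 := (abs_le.1 h1).1
    have h3 : r ≤ (s₀.re - 1) / 2 := min_le_right _ _
    rw [Complex.sub_re] at h2
    linarith
  have hsub : Metric.closedBall s₀ r ⊆ {s : ℂ | 1 < s.re} := fun z hz => hσ1.trans_le (hre z hz)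
  obtain ⟨m, hm0, hm⟩ : ∃ m : ℝ, 0 < m ∧ ∀ z ∈ Metric.sphere s₀ r, m ≤ ‖twistedSum χ N θ z‖ := by
    obtain ⟨z₁, hz₁, hmin⟩ := (isCompact_sphere s₀ r).exists_isMinOn
      (NormedSpace.sphere_nonempty.2 hrpos.le)
      (((differentiableOn_twistedSum χ N θ).mono
        (Metric.sphere_subset_closedBall.trans hsub)).continuousOn.norm)
    refine ⟨_, norm_pos_iff.2 (hball z₁ ?_ ?_), fun z hz => hmin hz⟩
    · rw [Metric.mem_ball, Metric.mem_sphere.1 hz₁]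
      exact (min_le_left _ _).trans_lt (by linarith)
    · intro h
      rw [Metric.mem_sphere, h, dist_self] at hz₁
      linarith
  intro hfin
  obtain ⟨T, hT⟩ := (hfin.image Complex.im).bddAbove
  have hN' : (1 : ℝ) ≤ N := by exact_mod_cast hN
  -- For `|Im (z - s₀)| ≤ r` this `t` forces `Im z + t ≥ T + 1`, beyond all the supposedly finitely
  -- many zeros.
  obtain ⟨t, htT, ht⟩ := exists_tsum_norm_exp_sub_lt hθ hσ1 (T + r + 1 - s₀.im)
    (m / (2 * (N * N))) (by positivity)
  have hclose : ∀ z ∈ Metric.closedBall s₀ r,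
      ‖twistedSum χ N (fun n => -(t * Real.log n)) z - twistedSum χ N θ z‖ < m / 2 := by
    intro z hz
    refine (norm_twistedSum_sub_le χ N hσ1 (hre z hz)).trans_lt ?_
    rw [lt_div_iff₀ (by positivity)] at ht
    linarith
  obtain ⟨z, hz, hz0⟩ := exists_eq_zero_of_norm_lt (m := m / 2) hrpos
    ((differentiableOn_twistedSum χ N (fun n => -(t * Real.log n))).mono hsub)
    (by simpa [hzero] using hclose s₀ (Metric.mem_closedBall_self hrpos.le))
    (fun z hz => by
      have h1 := hclose z (Metric.sphere_subset_closedBall hz)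
      have h2 := hm z hz
      have h3 := norm_sub_norm_le (twistedSum χ N θ z) (twistedSum χ N (fun n => -(t * Real.log n)) z)
      rw [norm_sub_rev] at h3
      linarith)
  rw [twistedSum_neg_mul_log] at hz0
  have h4 : z.im + t ≤ T := by
    have := hT (Set.mem_image_of_mem Complex.im (show z + t * Complex.I ∈ _ from
      ⟨by simpa using hσ1.trans_le (hre z hz), hz0⟩))
    simpa using this
  have h5 : |(z - s₀).im| ≤ r := (Complex.abs_im_le_norm _).trans (by simpa [dist_eq_norm] using hz)
  have h6 := (abs_le.1 h5).1
  rw [Complex.sub_im] at h6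
  linarith

/-! ### Mean value estimates for `exp` and `log` -/

theorem norm_exp_mul_I_sub_le (x y : ℝ) :
    ‖Complex.exp ((x : ℂ) * Complex.I) - Complex.exp ((y : ℂ) * Complex.I)‖ ≤ |x - y| := by
  have h : Complex.exp ((x : ℂ) * Complex.I) - Complex.exp ((y : ℂ) * Complex.I) =
      Complex.exp ((y : ℂ) * Complex.I) * (Complex.exp (Complex.I * ((x - y : ℝ) : ℂ)) - 1) := by
    rw [mul_sub, ← Complex.exp_add, mul_one]
    congr 2; push_cast; ring
  rw [h, norm_mul, Complex.norm_exp_ofReal_mul_I, one_mul]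
  exact Real.norm_exp_I_mul_ofReal_sub_one_le

/-- The derivative `i (exp (i t) - 1)` of `exp (i t) - i t` has norm at most `|t| ≤ ρ`. -/
theorem norm_exp_mul_I_sub_sub_le {ρ x y : ℝ} (hx : |x| ≤ ρ) (hy : |y| ≤ ρ) :
    ‖Complex.exp ((x : ℂ) * Complex.I) - Complex.exp ((y : ℂ) * Complex.I) -
      Complex.I * ((x - y : ℝ) : ℂ)‖ ≤ ρ * |x - y| := by
  have hd : ∀ t ∈ Set.Icc (-ρ) ρ, HasDerivWithinAt
      (fun t : ℝ => Complex.exp ((t : ℂ) * Complex.I) - (t : ℂ) * Complex.I)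
      (Complex.exp ((t : ℂ) * Complex.I) * (1 * Complex.I) - 1 * Complex.I) (Set.Icc (-ρ) ρ) t := by
    intro t _
    have h1 : HasDerivAt (fun t : ℝ => (t : ℂ) * Complex.I) (1 * Complex.I) t :=
      (Complex.ofRealCLM.hasDerivAt (x := t)).mul_const Complex.I
    exact (h1.cexp.sub h1).hasDerivWithinAt
  have h := (convex_Icc (-ρ) ρ).norm_image_sub_le_of_norm_hasDerivWithin_le (C := ρ) hd
    (fun t ht => ?_) (Set.mem_Icc.2 (abs_le.1 hy)) (Set.mem_Icc.2 (abs_le.1 hx))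
  · rw [Real.norm_eq_abs] at h
    refine le_trans (le_of_eq ?_) h
    congr 1; push_cast; ring
  · have hmul : Complex.exp ((t : ℂ) * Complex.I) * (1 * Complex.I) - 1 * Complex.I =
        (Complex.exp ((t : ℂ) * Complex.I) - 1) * Complex.I := by ring
    rw [hmul, norm_mul, Complex.norm_I, mul_one]
    have := norm_exp_mul_I_sub_le t 0
    simp only [Complex.ofReal_zero, zero_mul, Complex.exp_zero, sub_zero] at this
    exact this.trans (abs_le.2 ht)

/-- The derivative of `-log (1 - t) - t` is `t / (1 - t)`, of norm at most `2 a` when `‖t‖ ≤ a ≤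
1/2`. -/
theorem norm_log_one_sub_add_sub_le {a : ℝ} (ha : a ≤ 1 / 2) {u v : ℂ} (hu : ‖u‖ ≤ a)
    (hv : ‖v‖ ≤ a) : ‖(-Complex.log (1 - u) - u) - (-Complex.log (1 - v) - v)‖ ≤
      2 * a * ‖u - v‖ := by
  have hd : ∀ t ∈ Metric.closedBall (0 : ℂ) a, HasDerivWithinAt
      (fun t : ℂ => -Complex.log (1 - t) - t) (-(-1 / (1 - t)) - 1) (Metric.closedBall 0 a) t := by
    intro t ht
    have ht' : ‖t‖ ≤ a := by simpa using ht
    have h1 : HasDerivAt (fun t : ℂ => 1 - t) (-1) t := by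
      simpa using (hasDerivAt_id t).const_sub 1
    have hs : 1 - t ∈ Complex.slitPlane := by
      refine Or.inl ?_
      have := (Complex.re_le_norm t)
      simp only [Complex.sub_re, Complex.one_re]
      linarith
    exact ((h1.clog hs).neg.sub (hasDerivAt_id t)).hasDerivWithinAt
  refine (convex_closedBall (0 : ℂ) a).norm_image_sub_le_of_norm_hasDerivWithin_le (C := 2 * a) hd
    (fun t ht => ?_) (by simpa using hv) (by simpa using hu)
  have ht' : ‖t‖ ≤ a := by simpa using ht
  have h2 : 1 / 2 ≤ ‖1 - t‖ := by
    have := norm_sub_norm_le (1 : ℂ) t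
    rw [norm_one] at this
    linarith
  have h3 : (1 - t) ≠ 0 := norm_pos_iff.1 (by linarith)
  have h4 : -(-1 / (1 - t)) - 1 = t / (1 - t) := by field_simp; ring
  rw [h4, norm_div, div_le_iff₀ (by linarith)]
  nlinarith [norm_nonneg t]

/-- On this disc `Re t ≥ 7/20`, so `|1 / t| ≤ 20/7 < 3`. -/
theorem norm_log_sub_log_le {u v : ℂ} (hu : ‖u - 1‖ ≤ 13 / 20) (hv : ‖v - 1‖ ≤ 13 / 20) :
    ‖Complex.log u - Complex.log v‖ ≤ 3 * ‖u - v‖ := by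
  have hre : ∀ t ∈ Metric.closedBall (1 : ℂ) (13 / 20), 7 / 20 ≤ t.re := by
    intro t ht
    have ht' : ‖t - 1‖ ≤ 13 / 20 := by simpa [dist_eq_norm] using ht
    have := (abs_le.1 ((Complex.abs_re_le_norm _).trans ht')).1
    simp only [Complex.sub_re, Complex.one_re] at this
    linarith
  refine (convex_closedBall (1 : ℂ) (13 / 20)).norm_image_sub_le_of_norm_hasDerivWithin_le (C := 3)
    (f' := fun t => t⁻¹) (fun t ht => (Complex.hasDerivAt_log (Or.inl ?_)).hasDerivWithinAt)
    (fun t ht => ?_) (by simpa [dist_eq_norm] using hv) (by simpa [dist_eq_norm] using hu)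
  · have := hre t ht
    linarith
  · have h1 := (hre t ht).trans (Complex.re_le_norm t)
    rw [norm_inv]
    refine inv_le_of_inv_le₀ (by norm_num) ?_
    linarith

/-! ### Sums over residue classes modulo 4 -/

/-- The `n`-th of the angles that depend on the complex parameter `z`. -/
noncomputable def angle (n : ℕ) (z : ℂ) : ℝ :=
  if n % 4 = 0 then z.re else if n % 4 = 1 then z.im else 0

theorem abs_angle_sub_le (n : ℕ) (z w : ℂ) : |angle n z - angle n w| ≤ ‖z - w‖ := by
  unfold angle
  split_ifs
  · rw [← Complex.sub_re]; exact Complex.abs_re_le_norm _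
  · rw [← Complex.sub_im]; exact Complex.abs_im_le_norm _
  · simp

theorem angle_zero (n : ℕ) : angle n 0 = 0 := by simp [angle]

theorem abs_angle_le (n : ℕ) (z : ℂ) : |angle n z| ≤ ‖z‖ := by
  simpa [angle_zero] using abs_angle_sub_le n z 0

/-- The sum of `a` over the residue class of `j` modulo `4`. -/
noncomputable def classSum (a : ℕ → ℝ) (j : ℕ) : ℝ := ∑' n, a (4 * n + j)

section ClassSum
variable {a : ℕ → ℝ}

theorem hasSum_classSum (hs : Summable a) {j : ℕ} (hj : j < 4) :
    HasSum (fun n => if n % 4 = j then a n else 0) (classSum a j) := by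
  have hinj : Function.Injective fun n : ℕ => 4 * n + j := fun m n h => by
    simp only at h; omega
  rw [← hinj.hasSum_iff]
  · have : (fun n => if n % 4 = j then a n else 0) ∘ (fun n : ℕ => 4 * n + j) =
        fun n => a (4 * n + j) := by
      funext n
      simp only [Function.comp]
      rw [if_pos (by omega)]
    rw [this]
    exact (hs.comp_injective hinj).hasSum
  · intro n hn
    rw [if_neg]
    intro h
    exact hn ⟨n / 4, by change 4 * (n / 4) + j = n; omega⟩

theorem summable_class (hs : Summable a) (j : ℕ) : Summable fun n => a (4 * n + j) :=
  hs.comp_injective fun m n h => by change 4 * m + j = 4 * n + j at h; omega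

theorem classSum_le (ha : Antitone a) (hs : Summable a) (j : ℕ) :
    classSum a j ≤ classSum a 0 :=
  (summable_class hs j).tsum_le_tsum (fun n => ha (by omega)) (summable_class hs 0)

/-- Shifting the class of `0` by one block costs only `a 0`, so all four class sums agree up to `a
0`, however large they are. -/
theorem classSum_zero_sub_le (ha : Antitone a) (hs : Summable a) {j : ℕ} (hj : j < 4) :
    classSum a 0 - a 0 ≤ classSum a j := by
  have h : classSum a 0 = a 0 + ∑' n, a (4 * (n + 1)) := (summable_class hs 0).tsum_eq_zero_add
  have h2 : ∑' n, a (4 * (n + 1)) ≤ classSum a j :=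
    ((summable_nat_add_iff 1).2 (summable_class hs 0)).tsum_le_tsum (fun n => ha (by omega))
      (summable_class hs j)
  linarith

theorem tsum_le_four_mul_classSum (ha : Antitone a) (hs : Summable a) :
    ∑' n, a n ≤ 4 * classSum a 0 := by
  have h := (((hasSum_classSum hs (j := 0) (by norm_num)).add
    (hasSum_classSum hs (j := 1) (by norm_num))).add
    (hasSum_classSum hs (j := 2) (by norm_num))).add
    (hasSum_classSum hs (j := 3) (by norm_num))
  have he : (fun n => (((if n % 4 = 0 then a n else 0) + (if n % 4 = 1 then a n else 0)) +
      (if n % 4 = 2 then a n else 0)) + (if n % 4 = 3 then a n else 0)) = a := by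
    funext n
    have : n % 4 = 0 ∨ n % 4 = 1 ∨ n % 4 = 2 ∨ n % 4 = 3 := by omega
    rcases this with h | h | h | h <;> simp [h]
  rw [he] at h
  rw [h.tsum_eq]
  linarith [classSum_le ha hs 1, classSum_le ha hs 2, classSum_le ha hs 3]

theorem I_pow_eq_of_mod (n : ℕ) : Complex.I ^ n = if n % 4 = 0 then 1 else
    if n % 4 = 1 then Complex.I else if n % 4 = 2 then -1 else -Complex.I := by
  rw [Complex.I_pow_eq_pow_mod]
  have : n % 4 = 0 ∨ n % 4 = 1 ∨ n % 4 = 2 ∨ n % 4 = 3 := by omega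
  rcases this with h | h | h | h <;> simp [h, pow_succ]

/-- Classes `0, 2` and classes `1, 3` cancel in pairs, each up to `a 0`. -/
theorem norm_tsum_mul_I_pow_le (ha : Antitone a) (hs : Summable a) :
    ‖∑' n, (a n : ℂ) * Complex.I ^ n‖ ≤ 2 * a 0 := by
  have h := (((Complex.hasSum_ofReal.2 (hasSum_classSum hs (j := 0) (by norm_num))).sub
    (Complex.hasSum_ofReal.2 (hasSum_classSum hs (j := 2) (by norm_num)))).add
    (((Complex.hasSum_ofReal.2 (hasSum_classSum hs (j := 1) (by norm_num))).sub
    (Complex.hasSum_ofReal.2 (hasSum_classSum hs (j := 3) (by norm_num)))).mul_right Complex.I))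
  have he : ∀ n : ℕ, (a n : ℂ) * Complex.I ^ n =
      (((if n % 4 = 0 then a n else 0 : ℝ) : ℂ) - ((if n % 4 = 2 then a n else 0 : ℝ) : ℂ)) +
      (((if n % 4 = 1 then a n else 0 : ℝ) : ℂ) - ((if n % 4 = 3 then a n else 0 : ℝ) : ℂ)) *
        Complex.I := by
    intro n
    rw [I_pow_eq_of_mod]
    have : n % 4 = 0 ∨ n % 4 = 1 ∨ n % 4 = 2 ∨ n % 4 = 3 := by omega
    rcases this with h | h | h | h <;> simp [h]
  rw [tsum_congr he, h.tsum_eq, ← Complex.ofReal_sub, ← Complex.ofReal_sub]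
  refine (norm_add_le _ _).trans ?_
  rw [norm_mul, Complex.norm_I, mul_one, Complex.norm_real, Complex.norm_real, Real.norm_eq_abs,
    Real.norm_eq_abs]
  have h1 := classSum_le ha hs 1
  have h2 := classSum_le ha hs 2
  have h3 := classSum_le ha hs 3
  have h1' := classSum_zero_sub_le ha hs (j := 1) (by norm_num)
  have h2' := classSum_zero_sub_le ha hs (j := 2) (by norm_num)
  have h3' := classSum_zero_sub_le ha hs (j := 3) (by norm_num)
  have e1 : |classSum a 0 - classSum a 2| ≤ a 0 := abs_le.2 ⟨by linarith, by linarith⟩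
  have e2 : |classSum a 1 - classSum a 3| ≤ a 0 := abs_le.2 ⟨by linarith, by linarith⟩
  linarith

/-- The linear part in `z` of the twisted prime sum. Since the class sums of `0` and `1` nearly
agree, it is close to `i * classSum a 0 * z`. -/
theorem hasSum_mul_I_pow_mul_angle (hs : Summable a) (z : ℂ) :
    HasSum (fun n => (a n : ℂ) * Complex.I ^ n * (Complex.I * (angle n z : ℂ)))
      (Complex.I * (classSum a 0 * z.re + Complex.I * classSum a 1 * z.im)) := by
  have h := ((Complex.hasSum_ofReal.2 (hasSum_classSum hs (j := 0) (by norm_num))).mul_right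
    (Complex.I * z.re)).add
    ((Complex.hasSum_ofReal.2 (hasSum_classSum hs (j := 1) (by norm_num))).mul_right
    (Complex.I * Complex.I * z.im))
  have hv : Complex.I * (classSum a 0 * z.re + Complex.I * classSum a 1 * z.im) =
      classSum a 0 * (Complex.I * z.re) + classSum a 1 * (Complex.I * Complex.I * z.im) := by ring
  have hterm : (fun n => (a n : ℂ) * Complex.I ^ n * (Complex.I * (angle n z : ℂ))) =
      fun n => ((if n % 4 = 0 then a n else 0 : ℝ) : ℂ) * (Complex.I * z.re) +
        ((if n % 4 = 1 then a n else 0 : ℝ) : ℂ) * (Complex.I * Complex.I * z.im) := by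
    funext n
    rw [I_pow_eq_of_mod]
    unfold angle
    have : n % 4 = 0 ∨ n % 4 = 1 ∨ n % 4 = 2 ∨ n % 4 = 3 := by omega
    rcases this with h | h | h | h <;> simp [h, mul_assoc]
    linear_combination (a n * z.im : ℂ) * Complex.I_mul_I
  rw [hv, hterm]
  exact h

end ClassSum

/-! ### The logarithm of the Euler product -/

/-- The Euler factors `u n` with moduli `a n` and arguments `π n / 2 + angle n z`. -/
noncomputable def eulerTerm (a : ℕ → ℝ) (n : ℕ) (z : ℂ) : ℂ :=
  (a n : ℂ) * Complex.I ^ n * Complex.exp ((angle n z : ℂ) * Complex.I)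

/-- The logarithm of the Euler product with factors `eulerTerm a n z`. -/
noncomputable def eulerLog (a : ℕ → ℝ) (z : ℂ) : ℂ :=
  ∑' n, -Complex.log (1 - eulerTerm a n z)

section EulerLog
variable {a : ℕ → ℝ}

theorem norm_eulerTerm (h0 : ∀ n, 0 ≤ a n) (n : ℕ) (z : ℂ) : ‖eulerTerm a n z‖ = a n := by
  simp [eulerTerm, Complex.norm_exp_ofReal_mul_I, abs_of_nonneg (h0 n)]

theorem summable_eulerTerm (h0 : ∀ n, 0 ≤ a n) (hs : Summable a) (z : ℂ) :
    Summable fun n => eulerTerm a n z :=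
  Summable.of_norm (by simpa only [norm_eulerTerm h0] using hs)

theorem summable_log_eulerTerm (h0 : ∀ n, 0 ≤ a n) (hs : Summable a) (z : ℂ) :
    Summable fun n => -Complex.log (1 - eulerTerm a n z) :=
  (summable_eulerTerm h0 hs z).clog_one_sub.neg

theorem norm_eulerTerm_sub_le (h0 : ∀ n, 0 ≤ a n) (n : ℕ) (z w : ℂ) :
    ‖eulerTerm a n z - eulerTerm a n w‖ ≤ a n * ‖z - w‖ := by
  unfold eulerTerm
  rw [← mul_sub, norm_mul, norm_mul, norm_pow, Complex.norm_I, one_pow, mul_one, Complex.norm_real,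
    Real.norm_of_nonneg (h0 n)]
  exact mul_le_mul_of_nonneg_left
    ((norm_exp_mul_I_sub_le _ _).trans (abs_angle_sub_le n z w)) (h0 n)

theorem summable_sq_and_tsum_le (h0 : ∀ n, 0 ≤ a n) (h1 : ∀ n, a n ≤ 1 / ((n : ℝ) + 2)) :
    Summable (fun n => a n ^ 2) ∧ ∑' n, a n ^ 2 ≤ 2 := by
  have hz : Summable fun n : ℕ => 1 / ((n : ℝ) + 1) ^ 2 := by
    have := (summable_nat_add_iff 1).2 hasSum_zeta_two.summable
    simpa using this
  have hle : ∀ n, a n ^ 2 ≤ 1 / ((n : ℝ) + 1) ^ 2 := by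
    intro n
    have : a n ≤ 1 / ((n : ℝ) + 1) := (h1 n).trans (by gcongr; norm_num)
    have h2 := pow_le_pow_left₀ (h0 n) this 2
    rwa [div_pow, one_pow] at h2
  have hsum := Summable.of_nonneg_of_le (fun n => sq_nonneg (a n)) hle hz
  refine ⟨hsum, (hsum.tsum_le_tsum hle hz).trans ?_⟩
  have h3 := hasSum_zeta_two.summable.tsum_eq_zero_add
  rw [hasSum_zeta_two.tsum_eq] at h3
  simp only [Nat.cast_zero, Nat.cast_add, Nat.cast_one] at h3
  norm_num at h3
  simp only [one_div]
  rw [← h3]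
  have := Real.pi_lt_d4
  have := Real.pi_pos
  nlinarith

/-- The quadratic remainder of the logarithm gives `4`, the sum of the terms themselves at most `2 a
0 ≤ 1`. -/
theorem norm_eulerLog_zero_le (ha : Antitone a) (hs : Summable a) (h0 : ∀ n, 0 ≤ a n)
    (h1 : ∀ n, a n ≤ 1 / ((n : ℝ) + 2)) : ‖eulerLog a 0‖ ≤ 5 := by
  obtain ⟨hsq, hsq2⟩ := summable_sq_and_tsum_le h0 h1
  have hhalf : ∀ n, a n ≤ 1 / 2 := fun n => (h1 n).trans (by
    have : (0 : ℝ) ≤ n := n.cast_nonneg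
    gcongr; linarith)
  have hdecomp : eulerLog a 0 = ∑' n, (-Complex.log (1 - eulerTerm a n 0) - eulerTerm a n 0) +
      ∑' n, eulerTerm a n 0 := by
    rw [(summable_log_eulerTerm h0 hs 0).tsum_sub (summable_eulerTerm h0 hs 0), sub_add_cancel,
      eulerLog]
  have e1 : ‖∑' n, (-Complex.log (1 - eulerTerm a n 0) - eulerTerm a n 0)‖ ≤ 2 * 2 := by
    refine (tsum_of_norm_bounded (hsq.mul_left 2).hasSum fun n => ?_).trans
      (by rw [tsum_mul_left]; linarith)
    have := norm_log_one_sub_add_sub_le (hhalf n) (norm_eulerTerm h0 n 0).le (v := 0)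
      (by simpa using h0 n)
    simp only [sub_zero, Complex.log_one, neg_zero] at this
    rw [norm_eulerTerm h0] at this
    linarith
  have e2 : ‖∑' n, eulerTerm a n 0‖ ≤ 2 * a 0 := by
    simpa [eulerTerm, angle_zero] using norm_tsum_mul_I_pow_le ha hs
  have := hhalf 0
  rw [hdecomp]
  exact (norm_add_le _ _).trans (by linarith)

/-- Three errors: `4` from the remainder of the logarithm, `1` from replacing the class sum of `1`
by that of `0`, and `classSum a 0 / 4` from linearising `exp` on `|x| ≤ 1/16`, as the whole sum is
at most `4 * classSum a 0`. -/
theorem norm_eulerLog_sub_le (ha : Antitone a) (hs : Summable a) (h0 : ∀ n, 0 ≤ a n)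
    (h1 : ∀ n, a n ≤ 1 / ((n : ℝ) + 2)) {z w : ℂ} (hz : ‖z‖ ≤ 1 / 16) (hw : ‖w‖ ≤ 1 / 16) :
    ‖eulerLog a z - eulerLog a w - Complex.I * classSum a 0 * (z - w)‖ ≤
      (5 + classSum a 0 / 4) * ‖z - w‖ := by
  obtain ⟨hsq, hsq2⟩ := summable_sq_and_tsum_le h0 h1
  have hhalf : ∀ n, a n ≤ 1 / 2 := fun n => (h1 n).trans (by
    have : (0 : ℝ) ≤ n := n.cast_nonneg
    gcongr; linarith)
  set g : ℕ → ℂ → ℂ := fun n z => -Complex.log (1 - eulerTerm a n z) - eulerTerm a n z with hg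
  have hgs : ∀ z, Summable fun n => g n z := fun z =>
    (summable_log_eulerTerm h0 hs z).sub (summable_eulerTerm h0 hs z)
  have hdecomp : ∀ z, eulerLog a z = ∑' n, g n z + ∑' n, eulerTerm a n z := by
    intro z
    rw [(summable_log_eulerTerm h0 hs z).tsum_sub (summable_eulerTerm h0 hs z), sub_add_cancel,
      eulerLog]
  have e1 : ‖∑' n, g n z - ∑' n, g n w‖ ≤ 4 * ‖z - w‖ := by
    rw [← (hgs z).tsum_sub (hgs w)]
    refine (tsum_of_norm_bounded ((hsq.mul_left 2).mul_right ‖z - w‖).hasSum fun n => ?_).trans ?_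
    · refine (norm_log_one_sub_add_sub_le (hhalf n) (norm_eulerTerm h0 n z).le
        (norm_eulerTerm h0 n w).le).trans ?_
      have h2 := norm_eulerTerm_sub_le h0 n z w
      have h3 := h0 n
      calc 2 * a n * ‖eulerTerm a n z - eulerTerm a n w‖ ≤ 2 * a n * (a n * ‖z - w‖) := by gcongr
        _ = _ := by ring
    · rw [tsum_mul_right, tsum_mul_left]
      gcongr
      linarith
  set lin : ℕ → ℂ → ℂ := fun n z => (a n : ℂ) * Complex.I ^ n * (Complex.I * (angle n z : ℂ))
    with hlin
  have e2 : ‖∑' n, ((eulerTerm a n z - eulerTerm a n w) - (lin n z - lin n w))‖ ≤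
      classSum a 0 / 4 * ‖z - w‖ := by
    refine (tsum_of_norm_bounded ((hs.mul_right (1 / 16)).mul_right ‖z - w‖).hasSum
      fun n => ?_).trans ?_
    · have : (eulerTerm a n z - eulerTerm a n w) - (lin n z - lin n w) =
          (a n : ℂ) * Complex.I ^ n * (Complex.exp ((angle n z : ℂ) * Complex.I) -
            Complex.exp ((angle n w : ℂ) * Complex.I) -
            Complex.I * ((angle n z - angle n w : ℝ) : ℂ)) := by
        simp only [eulerTerm, hlin]; push_cast; ring
      rw [this, norm_mul, norm_mul, norm_pow, Complex.norm_I, one_pow, mul_one, Complex.norm_real,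
        Real.norm_of_nonneg (h0 n), mul_assoc]
      refine mul_le_mul_of_nonneg_left ((norm_exp_mul_I_sub_sub_le (ρ := 1 / 16)
        ((abs_angle_le n z).trans hz) ((abs_angle_le n w).trans hw)).trans ?_) (h0 n)
      gcongr
      exact abs_angle_sub_le n z w
    · rw [tsum_mul_right, tsum_mul_right]
      have := tsum_le_four_mul_classSum ha hs
      gcongr
      linarith
  have hls := fun z => hasSum_mul_I_pow_mul_angle hs z
  have e3 : ∑' n, ((eulerTerm a n z - eulerTerm a n w) - (lin n z - lin n w)) =
      (∑' n, eulerTerm a n z - ∑' n, eulerTerm a n w) -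
      (Complex.I * (classSum a 0 * z.re + Complex.I * classSum a 1 * z.im) -
        Complex.I * (classSum a 0 * w.re + Complex.I * classSum a 1 * w.im)) :=
    (((summable_eulerTerm h0 hs z).hasSum.sub (summable_eulerTerm h0 hs w).hasSum).sub
      ((hls z).sub (hls w))).tsum_eq
  have e4 : ‖((classSum a 0 - classSum a 1) * (z - w).im : ℝ)‖ ≤ ‖z - w‖ := by
    rw [norm_mul, Real.norm_eq_abs, Real.norm_eq_abs]
    have h2 := Complex.abs_im_le_norm (z - w)
    have h3 : |classSum a 0 - classSum a 1| ≤ 1 := by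
      have h4 := classSum_le ha hs 1
      have h5 := classSum_zero_sub_le ha hs (j := 1) (by norm_num)
      have h6 := hhalf 0
      exact abs_le.2 ⟨by linarith, by linarith⟩
    nlinarith [abs_nonneg (z - w).im, abs_nonneg (classSum a 0 - classSum a 1)]
  have e5 : eulerLog a z - eulerLog a w - Complex.I * classSum a 0 * (z - w) =
      (∑' n, g n z - ∑' n, g n w) +
      ∑' n, ((eulerTerm a n z - eulerTerm a n w) - (lin n z - lin n w)) +
      (((classSum a 0 - classSum a 1) * (z - w).im : ℝ) : ℂ) := by
    rw [hdecomp, hdecomp, e3]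
    have hz' : Complex.I * classSum a 0 * (z - w) =
        Complex.I * classSum a 0 * ((z.re + z.im * Complex.I) - (w.re + w.im * Complex.I)) := by
      rw [Complex.re_add_im, Complex.re_add_im]
    rw [hz']
    push_cast [Complex.sub_im]
    linear_combination ((classSum a 1 - classSum a 0) * (z.im - w.im) : ℂ) * Complex.I_mul_I
  rw [e5]
  refine (norm_add₃_le).trans ?_
  rw [Complex.norm_real]
  linarith

end EulerLog

/-! ### Surjectivity of a perturbed linear map -/

/-- Quantitative inverse function theorem: the image of the `ρ`-ball contains the ball of radius `(R
- R / 2) ρ` about `f 0`. -/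
theorem exists_eq_of_norm_sub_sub_le {f : ℂ → ℂ} {R ρ : ℝ} (hR : 0 < R) (hρ : 0 ≤ ρ) {c : ℂ}
    (hf : ∀ z w, ‖z‖ ≤ ρ → ‖w‖ ≤ ρ → ‖f z - f w - Complex.I * R * (z - w)‖ ≤ R / 2 * ‖z - w‖)
    (hc : ‖f 0 - c‖ ≤ R / 2 * ρ) : ∃ z, f z = c := by
  have hR0 : Complex.I * R ≠ 0 := by simp [hR.ne']
  set A : ℂ →L[ℂ] ℂ := (Complex.I * R) • ContinuousLinearMap.id ℂ ℂ with hA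
  have hRinv : ((R⁻¹.toNNReal : NNReal) : ℝ) = R⁻¹ := Real.coe_toNNReal _ (by positivity)
  have hRhalf : (((R / 2).toNNReal : NNReal) : ℝ) = R / 2 := Real.coe_toNNReal _ (by positivity)
  let B : A.NonlinearRightInverse :=
    { toFun := fun w => (Complex.I * R)⁻¹ * w
      nnnorm := R⁻¹.toNNReal
      bound' := fun w => by
        rw [hRinv]
        simp [abs_of_pos hR]
      right_inv' := fun w => mul_inv_cancel_left₀ hR0 w }
  have happ : ApproximatesLinearOn f A (Metric.closedBall 0 ρ) (R / 2).toNNReal := by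
    intro z hz w hw
    rw [hRhalf]
    simpa [hA] using hf z w (by simpa using hz) (by simpa using hw)
  have hsurj := happ.surjOn_closedBall_of_nonlinearRightInverse B hρ subset_rfl
  obtain ⟨z, -, hz⟩ := hsurj (show c ∈ _ by
    rw [Metric.mem_closedBall, dist_comm, dist_eq_norm]
    refine hc.trans (le_of_eq ?_)
    simp only [B]
    rw [hRinv, hRhalf, inv_inv]
    ring)
  exact ⟨z, hz⟩

/-! ### The primes not dividing `q` -/

theorem finite_prime_not_coprime {q : ℕ} (hq : q ≠ 0) :
    {p : ℕ | p.Prime ∧ ¬p.Coprime q}.Finite := by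
  refine (Set.finite_le_nat q).subset fun p hp => ?_
  exact Nat.le_of_dvd (Nat.pos_of_ne_zero hq) (by
    by_contra h
    exact hp.2 ((Nat.Prime.coprime_iff_not_dvd hp.1).2 h))

/-- The predicate enumerated by `primeSeq`. -/
def IsPrimeCoprime (q p : ℕ) : Prop := p.Prime ∧ p.Coprime q

/-- The increasing enumeration of the primes not dividing `q`. -/
noncomputable def primeSeq (q n : ℕ) : ℕ := Nat.nth (IsPrimeCoprime q) n

section PrimeSeq
variable {q : ℕ}

theorem infinite_isPrimeCoprime (hq : q ≠ 0) : {p | IsPrimeCoprime q p}.Infinite := by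
  intro h
  refine Nat.infinite_setOfPred_prime ((h.union (finite_prime_not_coprime hq)).subset fun p hp => ?_)
  by_cases hc : p.Coprime q
  · exact Or.inl ⟨hp, hc⟩
  · exact Or.inr ⟨hp, hc⟩

theorem isPrimeCoprime_primeSeq (hq : q ≠ 0) (n : ℕ) : IsPrimeCoprime q (primeSeq q n) :=
  Nat.nth_mem_of_infinite (infinite_isPrimeCoprime hq) n

theorem strictMono_primeSeq (hq : q ≠ 0) : StrictMono (primeSeq q) :=
  Nat.nth_strictMono (infinite_isPrimeCoprime hq)

theorem exists_primeSeq_eq {p : ℕ} (hp : IsPrimeCoprime q p) : ∃ n, primeSeq q n = p := by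
  classical
  exact ⟨Nat.count (IsPrimeCoprime q) p, Nat.nth_count hp⟩

theorem add_two_le_primeSeq (hq : q ≠ 0) (n : ℕ) : n + 2 ≤ primeSeq q n := by
  induction n with
  | zero => exact (isPrimeCoprime_primeSeq hq 0).1.two_le
  | succ n ih =>
    have := strictMono_primeSeq hq (Nat.lt_add_one n)
    omega

theorem not_summable_one_div_primeSeq (hq : q ≠ 0) :
    ¬Summable fun n => (1 : ℝ) / primeSeq q n := by
  intro h
  refine not_summable_one_div_on_primes ?_
  have h1 : Summable (Set.indicator {p | IsPrimeCoprime q p} (fun n : ℕ => (1 : ℝ) / n)) := by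
    rw [← (strictMono_primeSeq hq).injective.summable_iff]
    · refine h.congr fun n => ?_
      simp only [Function.comp]
      rw [Set.indicator_of_mem (show primeSeq q n ∈ {p | IsPrimeCoprime q p} from
        isPrimeCoprime_primeSeq hq n)]
    · intro p hp
      have hp' : p ∉ {p | IsPrimeCoprime q p} := fun h => hp (exists_primeSeq_eq h)
      exact Set.indicator_of_notMem hp' _
  refine (summable_congr_cofinite ?_).1 h1
  have hfin := finite_prime_not_coprime hq
  filter_upwards [hfin.compl_mem_cofinite] with p hp
  by_cases hpp : p.Prime
  · have hc : p.Coprime q := by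
      by_contra hc
      exact hp ⟨hpp, hc⟩
    rw [Set.indicator_of_mem (show p ∈ {p | IsPrimeCoprime q p} from ⟨hpp, hc⟩),
      Set.indicator_of_mem (show p ∈ {p | p.Prime} from hpp)]
  · have h2 : p ∉ {p | IsPrimeCoprime q p} := fun h => hpp h.1
    have h3 : p ∉ {p : ℕ | p.Prime} := hpp
    rw [Set.indicator_of_notMem h2, Set.indicator_of_notMem h3]

/-- The moduli of the Euler factors at the primes not dividing `q`. -/
noncomputable def primeWeight (q : ℕ) (σ : ℝ) (n : ℕ) : ℝ := (primeSeq q n : ℝ) ^ (-σ)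

theorem primeWeight_nonneg (σ : ℝ) (n : ℕ) : 0 ≤ primeWeight q σ n := by
  unfold primeWeight; positivity

theorem antitone_primeWeight (hq : q ≠ 0) {σ : ℝ} (hσ : 1 < σ) : Antitone (primeWeight q σ) := by
  intro m n hmn
  have h1 : (0 : ℝ) < primeSeq q m := by
    exact_mod_cast (isPrimeCoprime_primeSeq hq m).1.pos
  exact Real.rpow_le_rpow_of_nonpos h1
    (by exact_mod_cast (strictMono_primeSeq hq).monotone hmn) (by linarith)

theorem summable_primeWeight (hq : q ≠ 0) {σ : ℝ} (hσ : 1 < σ) : Summable (primeWeight q σ) :=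
  (summable_rpow_neg hσ).comp_injective (strictMono_primeSeq hq).injective

theorem primeWeight_le (hq : q ≠ 0) {σ : ℝ} (hσ : 1 < σ) (n : ℕ) :
    primeWeight q σ n ≤ 1 / ((n : ℝ) + 2) := by
  have h1 : (n : ℝ) + 2 ≤ primeSeq q n := by exact_mod_cast add_two_le_primeSeq hq n
  have h2 : (0 : ℝ) ≤ n := n.cast_nonneg
  unfold primeWeight
  calc (primeSeq q n : ℝ) ^ (-σ) ≤ (primeSeq q n : ℝ) ^ (-1 : ℝ) :=
        Real.rpow_le_rpow_of_exponent_le (by linarith) (by linarith)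
    _ = (primeSeq q n : ℝ)⁻¹ := Real.rpow_neg_one _
    _ ≤ 1 / ((n : ℝ) + 2) := by rw [one_div]; gcongr

/-- The reciprocals of these primes have divergent sum; a large finite partial sum is continuous in
`σ` and so survives a move from `1` to some `σ > 1`. -/
theorem exists_le_classSum_primeWeight (hq : q ≠ 0) (X : ℝ) :
    ∃ σ, 1 < σ ∧ X ≤ classSum (primeWeight q σ) 0 := by
  obtain ⟨K, hK⟩ : ∃ K : ℕ, 4 * X < ∑ n ∈ Finset.range K, (1 : ℝ) / primeSeq q n :=
    (((not_summable_iff_tendsto_nat_atTop_of_nonneg (fun n => by positivity)).1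
      (not_summable_one_div_primeSeq hq)).eventually_gt_atTop (4 * X)).exists
  have hcont : Tendsto (fun σ : ℝ => ∑ n ∈ Finset.range K, primeWeight q σ n) (𝓝[>] 1)
      (𝓝 (∑ n ∈ Finset.range K, primeWeight q 1 n)) := by
    refine tendsto_finsetSum _ fun n _ => ?_
    have h1 : (primeSeq q n : ℝ) ≠ 0 := by
      exact_mod_cast (isPrimeCoprime_primeSeq hq n).1.ne_zero
    have h2 : Continuous fun σ : ℝ => primeWeight q σ n :=
      (Real.continuous_const_rpow h1).comp continuous_neg
    exact (h2.tendsto 1).mono_left nhdsWithin_le_nhds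
  have heq : ∑ n ∈ Finset.range K, primeWeight q 1 n =
      ∑ n ∈ Finset.range K, (1 : ℝ) / primeSeq q n :=
    Finset.sum_congr rfl fun n _ => by rw [primeWeight, Real.rpow_neg_one, one_div]
  rw [heq] at hcont
  obtain ⟨σ, hσX, hσ⟩ := ((hcont.eventually (lt_mem_nhds hK)).and self_mem_nhdsWithin).exists
  refine ⟨σ, hσ, ?_⟩
  have h1 := (summable_primeWeight hq hσ).sum_le_tsum (Finset.range K)
    (fun n _ => primeWeight_nonneg σ n)
  have h2 := tsum_le_four_mul_classSum (antitone_primeWeight hq hσ) (summable_primeWeight hq hσ)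
  linarith

end PrimeSeq

/-! ### A twisted sum with a zero -/

open Classical in
/-- Angles on the primes for which the Euler factor of `χ` at `primeSeq q n` has the argument
`π n / 2 + angle n z`. -/
noncomputable def primeAngle {q : ℕ} (χ : DirichletCharacter ℂ q) (z : ℂ) (p : ℕ) : ℝ :=
  -(χ (p : ZMod q)).arg + Real.pi / 2 * Nat.count (IsPrimeCoprime q) p +
    angle (Nat.count (IsPrimeCoprime q) p) z

section Twist
variable {q : ℕ} (χ : DirichletCharacter ℂ q)

theorem abs_primeAngle_sub_le (z w : ℂ) (p : ℕ) :
    |primeAngle χ z p - primeAngle χ w p| ≤ ‖z - w‖ := by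
  unfold primeAngle
  rw [add_sub_add_left_eq_sub]
  exact abs_angle_sub_le _ z w

/-- At a prime not dividing `q` the character value has modulus `1`, and `primeAngle` subtracts its
argument. -/
theorem char_mul_exp_primeAngle (hq : q ≠ 0) (z : ℂ) (n : ℕ) :
    χ (primeSeq q n : ZMod q) * Complex.exp ((primeAngle χ z (primeSeq q n) : ℂ) * Complex.I) =
      Complex.I ^ n * Complex.exp ((angle n z : ℂ) * Complex.I) := by
  classical
  have hcount : Nat.count (IsPrimeCoprime q) (primeSeq q n) = n :=
    Nat.count_nth_of_infinite (infinite_isPrimeCoprime hq) n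
  have hunit : ‖χ (primeSeq q n : ZMod q)‖ = 1 := by
    have := χ.unit_norm_eq_one (ZMod.unitOfCoprime _ (isPrimeCoprime_primeSeq hq n).2)
    simpa using this
  have harg := Complex.norm_mul_exp_arg_mul_I (χ (primeSeq q n : ZMod q))
  rw [hunit, Complex.ofReal_one, one_mul] at harg
  unfold primeAngle
  conv_lhs => rw [← harg]
  have hI : Complex.I ^ n = Complex.exp ((n : ℂ) * (Real.pi / 2 * Complex.I)) := by
    rw [Complex.exp_nat_mul, Complex.exp_pi_div_two_mul_I]
  rw [hI, ← Complex.exp_add, ← Complex.exp_add, harg]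
  congr 1
  have hc : ∀ (h : DecidablePred (IsPrimeCoprime q)),
      @Nat.count (IsPrimeCoprime q) h (primeSeq q n) = n := fun h => by
    rw [← hcount]; congr!
  rw [hc]
  push_cast
  ring

/-- The twisted summand `χ n * exp (i θ n) * n ^ (-σ)` as a completely multiplicative function. -/
noncomputable def twistHom (θ : ℕ → ℝ) {σ : ℝ} (hσ : σ ≠ 0) : ℕ →*₀ ℂ where
  toFun n := χ (n : ZMod q) * Complex.exp ((addExt θ n : ℂ) * Complex.I) * ((n : ℝ) ^ (-σ) : ℝ)
  map_zero' := by simp [Real.zero_rpow (neg_ne_zero.2 hσ)]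
  map_one' := by simp [addExt]
  map_mul' m n := by
    rcases eq_or_ne m 0 with rfl | hm
    · simp [Real.zero_rpow (neg_ne_zero.2 hσ)]
    rcases eq_or_ne n 0 with rfl | hn
    · simp [Real.zero_rpow (neg_ne_zero.2 hσ)]
    rw [addExt_mul θ hm hn, Nat.cast_mul, Nat.cast_mul, map_mul,
      Real.mul_rpow m.cast_nonneg n.cast_nonneg]
    push_cast
    rw [add_mul, Complex.exp_add]
    ring

/-- The Euler product of a completely multiplicative function; primes dividing `q` contribute `-log
1 = 0`. -/
theorem exp_eulerLog_eq_LSeries (hq : q ≠ 0) {σ : ℝ} (hσ : 1 < σ) (z : ℂ) :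
    Complex.exp (eulerLog (primeWeight q σ) z) = LSeries (fun n : ℕ => χ (n : ZMod q) *
      Complex.exp ((addExt (primeAngle χ z) n : ℂ) * Complex.I)) σ := by
  have hσ0 : σ ≠ 0 := by linarith
  set f := twistHom χ (primeAngle χ z) hσ0 with hf
  have hfn : ∀ n : ℕ, f n = χ (n : ZMod q) *
      Complex.exp ((addExt (primeAngle χ z) n : ℂ) * Complex.I) * ((n : ℝ) ^ (-σ) : ℝ) :=
    fun n => rfl
  have hsum : Summable fun n => ‖f n‖ := by
    refine Summable.of_nonneg_of_le (fun n => norm_nonneg _) (fun n => ?_) (summable_rpow_neg hσ)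
    rw [hfn, norm_mul, norm_mul, Complex.norm_exp_ofReal_mul_I, mul_one, Complex.norm_real,
      Real.norm_of_nonneg (by positivity : 0 ≤ (n : ℝ) ^ (-σ))]
    exact mul_le_of_le_one_left (by positivity) (χ.norm_le_one _)
  have hE := EulerProduct.exp_tsum_primes_log_eq_tsum hsum
  have hL : LSeries (fun n : ℕ => χ (n : ZMod q) *
      Complex.exp ((addExt (primeAngle χ z) n : ℂ) * Complex.I)) σ = ∑' n, f n := by
    refine tsum_congr fun n => ?_
    rcases eq_or_ne n 0 with rfl | hn
    · simp
    · rw [LSeries.term_of_ne_zero hn, hfn, Complex.ofReal_cpow n.cast_nonneg, Complex.ofReal_neg,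
        Complex.cpow_neg, div_eq_mul_inv, Complex.ofReal_natCast]
  rw [hL, ← hE]
  congr 1
  let e : ℕ → Nat.Primes := fun n => ⟨primeSeq q n, (isPrimeCoprime_primeSeq hq n).1⟩
  have he : Function.Injective e := fun m n h =>
    (strictMono_primeSeq hq).injective (congrArg Subtype.val h)
  rw [← he.tsum_eq]
  · refine tsum_congr fun n => ?_
    congr 3
    change _ = f (primeSeq q n)
    rw [hfn, addExt_prime _ (isPrimeCoprime_primeSeq hq n).1, char_mul_exp_primeAngle χ hq,
      eulerTerm, primeWeight]
    ring
  · intro p hp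
    by_contra hne
    refine hp ?_
    have hnc : ¬(p : ℕ).Coprime q := fun hc => by
      obtain ⟨n, hn⟩ := exists_primeSeq_eq (q := q) ⟨p.2, hc⟩
      exact hne ⟨n, Subtype.ext hn⟩
    have h0 : χ ((p : ℕ) : ZMod q) = 0 :=
      χ.map_nonunit fun hu => hnc ((ZMod.isUnit_iff_coprime _ _).1 hu)
    simp [hfn, h0]

/-- The terms `2 ≤ k ≤ N` of the twisted sum. -/
noncomputable def twistTail (N : ℕ) (σ : ℝ) (z : ℂ) : ℂ :=
  ∑ k ∈ Finset.Icc 2 N, LSeries (fun n : ℕ => χ (n : ZMod q) *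
    Complex.exp (((k * addExt (primeAngle χ z) n : ℝ) : ℂ) * Complex.I)) ((k : ℂ) * (σ : ℂ))

theorem twistedSum_eq_add_twistTail (hq : q ≠ 0) {N : ℕ} (hN : 2 ≤ N) {σ : ℝ} (hσ : 1 < σ) (z : ℂ) :
    twistedSum χ N (addExt (primeAngle χ z)) σ =
      Complex.exp (eulerLog (primeWeight q σ) z) + twistTail χ N σ z := by
  have h : Finset.Icc 1 N = insert 1 (Finset.Icc 2 N) := by
    ext k; simp only [Finset.mem_Icc, Finset.mem_insert]; omega
  rw [exp_eulerLog_eq_LSeries χ hq hσ, twistedSum, h, Finset.sum_insert (by simp), twistTail]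
  simp

theorem two_le_re_natCast_mul {k : ℕ} (hk : 2 ≤ k) {σ : ℝ} (hσ : 1 < σ) :
    2 ≤ ((k : ℂ) * (σ : ℂ)).re := by
  have hk' : (2 : ℝ) ≤ k := by exact_mod_cast hk
  rw [← Complex.ofReal_natCast, ← Complex.ofReal_mul, Complex.ofReal_re]
  nlinarith

theorem norm_twistTail_div_sub_one_le {N : ℕ} (hN : 2 ≤ N) {σ : ℝ} (hσ : 1 < σ) (z : ℂ) :
    ‖twistTail χ N σ z / ((N - 1 : ℝ) : ℂ) - 1‖ ≤ 13 / 20 := by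
  have hN' : (2 : ℝ) ≤ N := by exact_mod_cast hN
  have hN0 : ((N - 1 : ℝ) : ℂ) ≠ 0 := by
    rw [Complex.ofReal_ne_zero]; linarith
  have hcard : ((Finset.Icc 2 N).card : ℝ) = N - 1 := by
    rw [Nat.card_Icc, Nat.cast_sub (by omega)]; push_cast; ring
  have hcard' : ((Finset.Icc 2 N).card : ℂ) = ((N - 1 : ℝ) : ℂ) := by
    rw [← hcard]; simp
  have h1 : ‖twistTail χ N σ z - ((N - 1 : ℝ) : ℂ)‖ ≤ (N - 1) * (13 / 20) := by
    have h2 : twistTail χ N σ z - ((N - 1 : ℝ) : ℂ) = ∑ k ∈ Finset.Icc 2 N,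
        (LSeries (fun n : ℕ => χ (n : ZMod q) * Complex.exp
          (((k * addExt (primeAngle χ z) n : ℝ) : ℂ) * Complex.I)) ((k : ℂ) * (σ : ℂ)) - 1) := by
      rw [Finset.sum_sub_distrib, ← hcard', twistTail]; simp
    rw [h2]
    refine (norm_sum_le_of_le _ (n := fun _ => (13 / 20 : ℝ)) fun k hk => ?_).trans (by
      rw [Finset.sum_const, nsmul_eq_mul, hcard])
    exact norm_LSeries_sub_one_le (two_le_re_natCast_mul (Finset.mem_Icc.1 hk).1 hσ)
      (norm_twist_le χ k _) (by simp [addExt])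
  have h3 : twistTail χ N σ z / ((N - 1 : ℝ) : ℂ) - 1 =
      (twistTail χ N σ z - ((N - 1 : ℝ) : ℂ)) / ((N - 1 : ℝ) : ℂ) := by
    field_simp
  rw [h3, norm_div, Complex.norm_real, Real.norm_of_nonneg (by linarith : (0 : ℝ) ≤ N - 1),
    div_le_iff₀ (by linarith)]
  linarith

theorem summable_log_mul_rpow : Summable fun n : ℕ => Real.log n * (n : ℝ) ^ (-2 : ℝ) := by
  refine Summable.of_nonneg_of_le (fun n => mul_nonneg (Real.log_natCast_nonneg n) (by positivity))
    (fun n => ?_) ((summable_rpow_neg (by norm_num : (1 : ℝ) < 3 / 2)).mul_left 2)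
  rcases eq_or_ne n 0 with rfl | hn
  · simp
  have hn' : (0 : ℝ) < n := by exact_mod_cast Nat.pos_of_ne_zero hn
  have h1 := Real.log_le_rpow_div n.cast_nonneg (by norm_num : (0 : ℝ) < 1 / 2)
  calc Real.log n * (n : ℝ) ^ (-2 : ℝ) ≤ ((n : ℝ) ^ (1 / 2 : ℝ) / (1 / 2)) * (n : ℝ) ^ (-2 : ℝ) := by
        gcongr
    _ = 2 * ((n : ℝ) ^ (1 / 2 : ℝ) * (n : ℝ) ^ (-2 : ℝ)) := by ring
    _ = 2 * (n : ℝ) ^ (-(3 / 2) : ℝ) := by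
        rw [← Real.rpow_add hn']; norm_num

/-- As `k ≥ 2`, the convergent sum of `log n / n ^ 2` serves for every `σ`. This uniformity lets `σ`
be chosen after `C`. -/
theorem exists_norm_twistTail_sub_le (N : ℕ) : ∃ C : ℝ, 0 ≤ C ∧ ∀ σ : ℝ, 1 < σ → ∀ z w : ℂ,
    ‖twistTail χ N σ z - twistTail χ N σ w‖ ≤ C * ‖z - w‖ := by
  set S : ℝ := ∑' n : ℕ, Real.log n * (n : ℝ) ^ (-2 : ℝ) with hS
  have hS0 : 0 ≤ S := tsum_nonneg fun n => mul_nonneg (Real.log_natCast_nonneg n) (by positivity)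
  refine ⟨∑ k ∈ Finset.Icc 2 N, (k : ℝ) * 2 * S, Finset.sum_nonneg fun k _ => by positivity,
    fun σ hσ z w => ?_⟩
  rw [twistTail, twistTail, ← Finset.sum_sub_distrib, Finset.sum_mul]
  refine norm_sum_le_of_le _ fun k hk => ?_
  have hb : ∀ n : ℕ, (k : ℝ) * (2 * ‖z - w‖ * Real.log n) * (n : ℝ) ^ (-2 : ℝ) =
      k * 2 * ‖z - w‖ * (Real.log n * (n : ℝ) ^ (-2 : ℝ)) := fun n => by ring
  refine (norm_LSeries_sub_le (by norm_num : (1 : ℝ) < 2)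
    (two_le_re_natCast_mul (Finset.mem_Icc.1 hk).1 hσ) (norm_twist_le χ k _) (norm_twist_le χ k _)
    (b := fun n => k * (2 * ‖z - w‖ * Real.log n)) (fun n _ => ?_) ?_).trans (le_of_eq ?_)
  · refine (norm_twist_sub_le χ k _ _ n).trans ?_
    gcongr
    exact (norm_exp_mul_I_sub_le _ _).trans
      (abs_addExt_sub_le (fun p _ => abs_primeAngle_sub_le χ z w p) n)
  · simp only [hb]
    exact summable_log_mul_rpow.mul_left _
  · simp only [hb]
    rw [tsum_mul_left]; ring

theorem exists_twistedSum_eq_zero (hq : q ≠ 0) {N : ℕ} (hN : 2 ≤ N) :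
    ∃ (σ : ℝ) (z : ℂ), 1 < σ ∧ twistedSum χ N (addExt (primeAngle χ z)) σ = 0 := by
  obtain ⟨C, hC0, hC⟩ := exists_norm_twistTail_sub_le χ N
  have hN' : (2 : ℝ) ≤ N := by exact_mod_cast hN
  -- A logarithm of `-(N - 1)`, so that `eulerLog = log G + c` makes the Euler product equal to
  -- minus the tail.
  set c : ℂ := (Real.log (N - 1) : ℂ) + Real.pi * Complex.I with hc
  obtain ⟨σ, hσ, hR⟩ := exists_le_classSum_primeWeight hq
    -- The first summand yields `5 + R / 4 + 3 C ≤ R / 2`. The second yields `7 + ‖c‖ ≤ (R / 2) /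
    -- 16`, where `7` covers `5 + 3 * (13/20)`, the size at `z = 0`.
    (4 * (5 + 3 * C) + 32 * (7 + ‖c‖))
  set R := classSum (primeWeight q σ) 0 with hRdef
  have hRpos : 0 < R := by
    have := norm_nonneg c
    linarith
  have hG := norm_twistTail_div_sub_one_le χ hN hσ
  set G : ℂ → ℂ := fun z => twistTail χ N σ z / ((N - 1 : ℝ) : ℂ) with hGdef
  have hGlip : ∀ z w, ‖G z - G w‖ ≤ C * ‖z - w‖ := by
    intro z w
    simp only [hGdef]
    rw [← sub_div, norm_div, Complex.norm_real, Real.norm_of_nonneg (by linarith : (0 : ℝ) ≤ N - 1)]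
    exact (div_le_self (norm_nonneg _) (by linarith)).trans (hC σ hσ z w)
  have ha := antitone_primeWeight hq hσ
  have hs := summable_primeWeight hq hσ
  have h0 := primeWeight_nonneg (q := q) σ
  have h1 := primeWeight_le hq hσ
  obtain ⟨z, hz⟩ := exists_eq_of_norm_sub_sub_le
    (f := fun z => eulerLog (primeWeight q σ) z - Complex.log (G z)) (c := c) hRpos
    (by norm_num : (0 : ℝ) ≤ 1 / 16)
    (fun z w hz hw => by
      have e1 := norm_eulerLog_sub_le ha hs h0 h1 hz hw
      have e2 := (norm_log_sub_log_le (hG z) (hG w)).trans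
        (mul_le_mul_of_nonneg_left (hGlip z w) (by norm_num))
      have e3 : (eulerLog (primeWeight q σ) z - Complex.log (G z)) -
          (eulerLog (primeWeight q σ) w - Complex.log (G w)) - Complex.I * R * (z - w) =
          (eulerLog (primeWeight q σ) z - eulerLog (primeWeight q σ) w -
            Complex.I * R * (z - w)) - (Complex.log (G z) - Complex.log (G w)) := by ring
      rw [e3]
      refine (norm_sub_le _ _).trans ?_
      have e4 : 5 + R / 4 + 3 * C ≤ R / 2 := by
        have := norm_nonneg c
        linarith
      have e5 := mul_le_mul_of_nonneg_right e4 (norm_nonneg (z - w))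
      linarith)
    (by
      have e1 := norm_eulerLog_zero_le ha hs h0 h1
      have e2 := norm_log_sub_log_le (hG 0) (v := 1) (by rw [sub_self, norm_zero]; norm_num)
      rw [Complex.log_one, sub_zero] at e2
      have e3 := hG 0
      refine (norm_sub_le _ _).trans ?_
      have e4 := norm_sub_le (eulerLog (primeWeight q σ) 0) (Complex.log (G 0))
      linarith)
  refine ⟨σ, z, hσ, ?_⟩
  rw [twistedSum_eq_add_twistTail χ hq hN hσ]
  have hG0 : G z ≠ 0 := by
    intro h
    have := hG z
    rw [show twistTail χ N σ z / ((N - 1 : ℝ) : ℂ) = G z from rfl, h, zero_sub, norm_neg,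
      norm_one] at this
    norm_num at this
  have hz' : eulerLog (primeWeight q σ) z = Complex.log (G z) + c := by
    rw [← hz]; ring
  have hN1 : (0 : ℝ) < N - 1 := by linarith
  have hexp : Complex.exp (Real.log (N - 1) : ℂ) = ((N - 1 : ℝ) : ℂ) := by
    rw [← Complex.ofReal_exp, Real.exp_log hN1]
  have hN10 : ((N - 1 : ℝ) : ℂ) ≠ 0 := Complex.ofReal_ne_zero.2 hN1.ne'
  rw [hz', hc, Complex.exp_add, Complex.exp_log hG0, Complex.exp_add, hexp, Complex.exp_pi_mul_I]
  simp only [hGdef]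
  field_simp
  ring

end Twist

theorem mainTheorem3 (N : ℕ) (hN : 2 ≤ N) (q : ℕ) (hq : 1 ≤ q) (χ : DirichletCharacter ℂ q) :
    {s : ℂ | 1 < s.re ∧
      ∑ k ∈ Finset.Icc 1 N, LSeries (fun n : ℕ => χ (n : ZMod q)) ((k : ℂ) * s) = 0}.Infinite := by
  obtain ⟨σ, z, hσ, hzero⟩ := exists_twistedSum_eq_zero χ (Nat.one_le_iff_ne_zero.1 hq) hN
  exact infinite_zeros_of_twistedSum_eq_zero χ (by omega)
    (fun m n hm hn => addExt_mul _ hm hn) (by simpa using hσ) hzero
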